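/- Let $d,d_1,d_2,d_3\ge 0$ be integers. Let $I=I_1\times\dots\times I_{d_1}$ with $I_i=[a_i,b_i]$, and $\Theta=\Theta_1\times\dots\times\Theta_{d_2+d_3}$ with $\Theta_j=[u_j,v_j]$, where $v_j-u_j=2\pi$ for $1\le j\le d_2$ and $v_j-u_j<2\pi$ for $d_2<j\le d_2+d_3$ (all intervals are compact and nonempty). Let $K=\sigma(I\times\Theta)\subset\mathbb{R}^d$, where each component $\sigma_\ell$ ($1\le\ell\le d$) of $\sigma:I\times\Theta\to\mathbb{R}^d$ lies in $\bigotimes_{i=1}^{d_1}\mathbb{P}_1(I_i)\otimes\bigotimes_{j=1}^{d_2+d_3}\mathbb{T}_1(\Theta_j)$; here $\mathbb{P}_1(I_i)$ is the space of univariate polynomials of degree at most $1$ restricted to $I_i$, and $\mathbb{T}_1(\Theta_j)=\mathrm{span}(1,\cos\theta,\sin\theta)$ restricted to $\Theta_j$. For real $\nu\ge 0$ let $X_\nu([a,b])$ be the set of the points $\frac{b-a}{2}\cos\frac{j\pi}{k}+\frac{a+b}{2}$, $0\le j\le k$, with $k=\lceil\nu\rceil$ (the Chebyshev--Lobatto nodes;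 $X_0([a,b])=\{b\}$), and let $W_\nu([u,v])$ be the set of the points $2\arcsin\left(\sin\left(\frac{\omega}{2}\right)\cos\frac{(2j+1)\pi}{2(k+1)}\right)+\frac{u+v}{2}$, $0\le j\le k$, with $\omega=\frac{v-u}{2}$ and $k=\lceil 2\nu\rceil$. For real $m>1$ and integer $n\ge 0$ put $$\mathcal{B}_n=\prod_{i=1}^{d_1}X_{mn}(I_i)\times\prod_{j=1}^{d_2+d_3}W_{mn}(\Theta_j),\qquad \mathcal{A}_n=\sigma(\mathcal{B}_n).$$ Write $\|f\|_X=\sup_{x\in X}|f(x)|$. Then, for every fixed real $m>1$, the sequence $(\mathcal{A}_n)_{n\ge 0}$ is a polynomial mesh of the compact set $K$; that is, each $\mathcal{A}_n$ is a finite subset of $K$, there is a constant $c>1$ such that $\|p\|_K\le c\,\|p\|_{\mathcal{A}_n}$ for all $n$ and all real $d$-variate polynomials $p$ of total degree at most $n$, and $\mathrm{card}(\mathcal{A}_n)=\mathcal{O}(N^s)$ as $n\to\infty$ for some $s\ge 1$, where $N=N(n)$ is the dimension of the space of restrictions to $K$ of the $d$-variate polynomials of total degree at most $n$. Moreover, for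 every $n\ge 0$, $$\|p\|_K\le\alpha^{d_1+d_2}\beta^{d_3}\,\|p\|_{\mathcal{A}_n}\quad\text{for all real $d$-variate polynomials $p$ of total degree at most $n$},$$ $$\mathrm{card}(\mathcal{A}_n)\le\lceil mn+1\rceil^{d_1}\,\lceil 2mn+1\rceil^{d_2+d_3},$$ where $\alpha=\frac{1}{\cos(\pi/(2m))}$ and $\beta=\frac{m}{m-1}$. -/

import Mathlib

noncomputable section

/-- The sup-norm `‖f‖_X` of a real function on a set `X` (used for bounded `f` and nonempty `X`). -/
def supNormOn {E : Type*} (X : Set E) (f : E → ℝ) : ℝ :=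
  sSup ((fun x => |f x|) '' X)

/-- Univariate algebraic polynomial functions of degree at most `n`. -/
def algSpace (n : ℕ) : Submodule ℝ (ℝ → ℝ) :=
  Submodule.span ℝ {f | ∃ k : ℕ, k ≤ n ∧ f = fun t => t ^ k}

/-- Univariate trigonometric polynomial functions of degree at most `n`:
the span of `1, cos θ, sin θ, …, cos (n θ), sin (n θ)`. -/
def trigSpace (n : ℕ) : Submodule ℝ (ℝ → ℝ) :=
  Submodule.span ℝ {f | ∃ k : ℕ, k ≤ n ∧
    ((f = fun θ => Real.cos (k * θ)) ∨ (f = fun θ => Real.sin (k * θ)))}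

/-- The tensor product of `r` copies of `algSpace n` and `q` copies of `trigSpace n`, realised as
the span of the products of univariate functions in separate variables. -/
def tensorSpace (r q n : ℕ) : Submodule ℝ ((Fin r → ℝ) × (Fin q → ℝ) → ℝ) :=
  Submodule.span ℝ {f | ∃ (g : Fin r → ℝ → ℝ) (h : Fin q → ℝ → ℝ),
    (∀ i, g i ∈ algSpace n) ∧ (∀ j, h j ∈ trigSpace n) ∧
    f = fun x => (∏ i, g i (x.1 i)) * ∏ j, h j (x.2 j)}

/-- The box `I × Θ`, with `I = [a₁,b₁] × ⋯ × [a_r,b_r]` and `Θ = [u₁,v₁] × ⋯ × [u_q,v_q]`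
(`Set.Icc` for the coordinatewise order is the product of the coordinate intervals). -/
def box {r q : ℕ} (a b : Fin r → ℝ) (u v : Fin q → ℝ) : Set ((Fin r → ℝ) × (Fin q → ℝ)) :=
  Set.Icc a b ×ˢ Set.Icc u v

/-- The restrictions to `K ⊆ ℝ^d` of the real `d`-variate polynomials of total degree at most `n`,
as a space of functions on `K`. -/
def polySpaceOn {d : ℕ} (K : Set (Fin d → ℝ)) (n : ℕ) : Submodule ℝ (K → ℝ) :=
  (MvPolynomial.restrictTotalDegree (Fin d) ℝ n).map
    (LinearMap.pi fun x : K => (MvPolynomial.aeval (R := ℝ) (x : Fin d → ℝ)).toLinearMap)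

/-- A polynomial mesh of a compact set `K ⊆ ℝ^d`: finite sets `A n ⊆ K` that norm the polynomials of
total degree at most `n` on `K` with a constant `c > 1` independent of the polynomial and of `n`, and
whose cardinality is `O(N^s)` for some `s ≥ 1`, with `N` the dimension of the space of restrictions
to `K` of the polynomials of total degree at most `n`. -/
def IsPolynomialMesh {d : ℕ} (K : Set (Fin d → ℝ)) (A : ℕ → Finset (Fin d → ℝ)) : Prop :=
  IsCompact K ∧
  (∀ n, (A n : Set (Fin d → ℝ)) ⊆ K) ∧
  (∃ c : ℝ, 1 < c ∧ ∀ (n : ℕ) (p : MvPolynomial (Fin d) ℝ), p.totalDegree ≤ n →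
    supNormOn K (fun x => MvPolynomial.eval x p) ≤
      c * supNormOn (A n : Set (Fin d → ℝ)) (fun x => MvPolynomial.eval x p)) ∧
  (∃ s : ℝ, 1 ≤ s ∧ (fun n => ((A n).card : ℝ)) =O[Filter.atTop]
    (fun n => (Module.finrank ℝ (polySpaceOn K n) : ℝ) ^ s))

/-- Chebyshev-Lobatto nodes `X_ν([a,b])`: the images of `cos (j π / k)`, `0 ≤ j ≤ k`, where `k = ⌈ν⌉`,
under the affine map from `[-1,1]` onto `[a,b]`. For `ν = 0` this is the single node `b`. -/
def lobattoNodes (ν : ℝ) (a b : ℝ) : Finset ℝ :=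
  (Finset.range (⌈ν⌉₊ + 1)).image
    (fun j : ℕ => (b - a) / 2 * Real.cos (j * Real.pi / (⌈ν⌉₊ : ℝ)) + (b + a) / 2)

/-- Chebyshev nodes `Z_k([-1,1])`: the `k + 1` zeros of the Chebyshev polynomial `T_{k+1}`. -/
def chebyshevNodes (k : ℕ) : Finset ℝ :=
  (Finset.range (k + 1)).image
    (fun j : ℕ => Real.cos ((2 * j + 1) * Real.pi / (2 * (k + 1))))

/-- The map `ψ_ω(s) = 2 arcsin (sin (ω / 2) s)`. -/
def psi (ω s : ℝ) : ℝ :=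
  2 * Real.arcsin (Real.sin (ω / 2) * s)

/-- Angular nodes `W_ν([u,v]) = ψ_ω(Z_{2ν}([-1,1])) + (u + v) / 2`, `ω = (v - u) / 2`, where the index
`2ν` is rounded up to an integer. -/
def angularNodes (ν : ℝ) (u v : ℝ) : Finset ℝ :=
  (chebyshevNodes ⌈2 * ν⌉₊).image (fun s => psi ((v - u) / 2) s + (u + v) / 2)

/-- The grid `B_n(m)` of nodes in the box `I × Θ`. -/
def boxGrid {r q : ℕ} (a b : Fin r → ℝ) (u v : Fin q → ℝ) (m : ℝ) (n : ℕ) :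
    Finset ((Fin r → ℝ) × (Fin q → ℝ)) :=
  Fintype.piFinset (fun i => lobattoNodes (m * n) (a i) (b i)) ×ˢ
    Fintype.piFinset (fun j => angularNodes (m * n) (u j) (v j))

/-- The mesh `A_n(m) = σ(B_n(m))`. -/
def sectionMesh {d r q : ℕ} (σ : (Fin r → ℝ) × (Fin q → ℝ) → Fin d → ℝ)
    (a b : Fin r → ℝ) (u v : Fin q → ℝ) (m : ℝ) (n : ℕ) : Finset (Fin d → ℝ) :=
  (boxGrid a b u v m n).image σ

end

/-! The core is a univariate comparison of Riesz type. Let w and z be the modulus and the direction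
of the point k cos t + i sin t of an ellipse, and let F(t) = w^N z^(-N) Q(z) with deg Q ≤ 2N
(`ellipticForms`). Over a half-open period z takes each value at most once, so a nonzero F has at
most 2N zeros there. The function cos(Nt - γ) is of the same kind. Comparing the two near a global
extremum τ of F gives |F(t)| ≥ |F(τ)| cos(N(t - τ)) as long as N|t - τ| < π/2 (`abs_mul_cos_le`).
Hence points that come within N|s - t| ≤ π/(2m) of every parameter t in [0, π] norm F with constant
α = 1/cos(π/(2m)) (`abs_le_of_mem_ellipticForms`).

Three substitutions turn the nodes into such points, equally spaced in t: x = A cos t + B for an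
algebraic variable (k = 1, N = n), θ = π - 2t + c for a full period (k = 1, N = 2n), and θ = ψ_ω(cos
t) + c for a shorter arc (k = cos(ω/2), N = 2n). The shorter arcs thus also get the constant α, and
α ≤ β (`one_div_cos_le`).

A polynomial of degree at most n composed with σ is, in each variable separately, an algebraic or
trigonometric polynomial of degree at most n. The univariate inequalities are therefore applied one
variable at a time and their constants multiply (`abs_eval_le_of_boxGrid`).

For the growth condition, K is connected. Either it is a point, or some coordinate takes infinitely
many values on it and N(n) ≥ n + 1; the cardinality is bounded by a power of n + 1
(`isBigO_card_of_isPreconnected`). -/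

noncomputable section

/-! ### Counting zeros from sign changes. -/

/-- If a continuous function strictly alternates in sign along `q 0 < q 1 < ⋯ < q n`, it has at least
`n` zeros in `(q 0, q n)`. -/
theorem exists_finset_zeros_of_alternating {D : ℝ → ℝ} (hD : Continuous D) {n : ℕ} {q : ℕ → ℝ}
    (hq : ∀ i < n, q i < q (i + 1)) (hs : ∀ i ≤ n, 0 < (-1) ^ i * D (q i)) :
    ∃ S : Finset ℝ, S.card = n ∧ ∀ s ∈ S, D s = 0 ∧ q 0 < s ∧ s < q n := by
  have hz : ∀ i, i < n → ∃ s, q i < s ∧ s < q (i + 1) ∧ D s = 0 := by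
    intro i hi
    have h1 := hs i hi.le
    have h2 := hs (i + 1) hi
    have hc : ContinuousOn (fun x => (-1) ^ i * D x) (Set.Icc (q i) (q (i + 1))) := by fun_prop
    obtain ⟨s, hsm, hs0⟩ := intermediate_value_Ioo' (hq i hi).le hc
      (show (0 : ℝ) ∈ _ from ⟨by rw [pow_succ] at h2; linarith, h1⟩)
    refine ⟨s, hsm.1, hsm.2, ?_⟩
    simpa using hs0
  choose! ξ hξ1 hξ2 hξ3 using hz
  have hmono : ∀ i j, i ≤ j → j ≤ n → q i ≤ q j := by
    intro i j hij
    induction j, hij using Nat.le_induction with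
    | base => intro _; exact le_rfl
    | succ j _ ih => intro hj; exact (ih (by omega)).trans (hq j (by omega)).le
  have hlt : ∀ i j, i < j → j < n → ξ i < ξ j := fun i j hij hj =>
    (hξ2 i (by omega)).trans_le ((hmono (i + 1) j hij hj.le).trans (hξ1 j hj).le)
  refine ⟨(Finset.range n).image ξ, ?_, ?_⟩
  · rw [Finset.card_image_of_injOn, Finset.card_range]
    intro i hi j hj h
    simp only [Finset.coe_range, Set.mem_Iio] at hi hj
    rcases lt_trichotomy i j with hij | hij | hij
    · exact absurd h (hlt i j hij hj).ne
    · exact hij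
    · exact absurd h (hlt j i hij hi).ne'
  · intro s hs'
    simp only [Finset.mem_image, Finset.mem_range] at hs'
    obtain ⟨i, hi, rfl⟩ := hs'
    exact ⟨hξ3 i hi, (hmono 0 i (by omega) hi.le).trans_lt (hξ1 i hi),
      (hξ2 i hi).trans_le (hmono (i + 1) n hi le_rfl)⟩

/-! ### Forms on an ellipse and the bound on their zeros. -/

/-- The distance to the origin of the point of parameter `t` of the ellipse with semi-axes `k`, `1`. -/
def ellipseRadius (k t : ℝ) : ℝ := √(Real.sin t ^ 2 + k ^ 2 * Real.cos t ^ 2)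

/-- The radial projection to the unit circle of the point of parameter `t` of the ellipse with
semi-axes `k`, `1`. -/
def ellipseDir (k t : ℝ) : ℂ :=
  (k * Real.cos t / ellipseRadius k t : ℝ) + (Real.sin t / ellipseRadius k t : ℝ) * Complex.I

theorem ellipseRadius_pos {k : ℝ} (hk : 0 < k) (t : ℝ) : 0 < ellipseRadius k t := by
  apply Real.sqrt_pos.2
  rcases eq_or_ne (Real.cos t) 0 with h | h
  · have := Real.sin_sq_add_cos_sq t
    rw [h] at this ⊢
    nlinarith
  · positivity

theorem sq_ellipseRadius (k t : ℝ) :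
    ellipseRadius k t ^ 2 = Real.sin t ^ 2 + k ^ 2 * Real.cos t ^ 2 :=
  Real.sq_sqrt (by positivity)

theorem ellipseDir_mul_conj {k : ℝ} (hk : 0 < k) (t : ℝ) :
    ellipseDir k t * (starRingEnd ℂ) (ellipseDir k t) = 1 := by
  have h := ellipseRadius_pos hk t
  rw [Complex.mul_conj, ellipseDir, Complex.normSq_add_mul_I]
  norm_cast
  field_simp
  linarith [sq_ellipseRadius k t]

theorem ellipseDir_ne_zero {k : ℝ} (hk : 0 < k) (t : ℝ) : ellipseDir k t ≠ 0 := by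
  intro h
  simpa [h] using ellipseDir_mul_conj hk t

/-- Equal directions make (cos s, sin s) a positive multiple of (cos t, sin t). Both are unit
vectors, so the factor is 1 and the parameters differ by a multiple of 2π. -/
theorem ellipseDir_injOn {k : ℝ} (hk : 0 < k) (a : ℝ) :
    Set.InjOn (ellipseDir k) (Set.Ico a (a + 2 * Real.pi)) := by
  intro s hs t ht h
  have hws := ellipseRadius_pos hk s
  have hwt := ellipseRadius_pos hk t
  have hre : k * Real.cos s / ellipseRadius k s = k * Real.cos t / ellipseRadius k t := by
    simpa [ellipseDir, -Complex.ofReal_cos, -Complex.ofReal_sin] using congrArg Complex.re h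
  have him : Real.sin s / ellipseRadius k s = Real.sin t / ellipseRadius k t := by
    simpa [ellipseDir, -Complex.ofReal_cos, -Complex.ofReal_sin] using congrArg Complex.im h
  set r := ellipseRadius k s / ellipseRadius k t with hr
  have hr0 : 0 < r := by positivity
  have hc : Real.cos s = r * Real.cos t := by
    rw [hr]; field_simp at hre ⊢; linarith
  have hsn : Real.sin s = r * Real.sin t := by
    rw [hr]; field_simp at him ⊢; linarith
  have hr1 : r = 1 := by
    have h1 := Real.sin_sq_add_cos_sq s
    have h2 := Real.sin_sq_add_cos_sq t
    rw [hc, hsn] at h1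
    have : r ^ 2 = 1 := by linear_combination h1 - r ^ 2 * h2
    nlinarith
  rw [hr1, one_mul] at hc hsn
  obtain ⟨j, hj⟩ := Real.Angle.angle_eq_iff_two_pi_dvd_sub.1 (Real.Angle.cos_sin_inj hc hsn)
  have hpi := Real.pi_pos
  have h1 : (j : ℝ) < 1 := by
    have := hs.2; have := ht.1
    by_contra hcon
    nlinarith
  have h2 : (-1 : ℝ) < j := by
    have := hs.1; have := ht.2
    by_contra hcon
    nlinarith
  have : j = 0 := by
    have h1' : j < 1 := by exact_mod_cast h1
    have h2' : -1 < j := by exact_mod_cast h2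
    omega
  rw [this] at hj
  simp at hj
  linarith

open Polynomial in
/-- The functions `F` for which `F t = w ^ N * z ^ (-N) * Q z`, with `Q` a polynomial of degree at
most `2 * N` in `z = ellipseDir k t`, and `w = ellipseRadius k t`. For `k = 1` these are the
trigonometric polynomials of degree at most `N`. -/
def ellipticForms (k : ℝ) (N : ℕ) : Submodule ℂ (ℝ → ℂ) where
  carrier := {F | ∃ Q : ℂ[X], Q.natDegree ≤ 2 * N ∧
    ∀ t, F t * ellipseDir k t ^ N = (ellipseRadius k t : ℂ) ^ N * Q.eval (ellipseDir k t)}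
  zero_mem' := ⟨0, by simp, by simp⟩
  add_mem' := by
    rintro F G ⟨P, hP, hF⟩ ⟨Q, hQ, hG⟩
    refine ⟨P + Q, natDegree_add_le_of_degree_le hP hQ, fun t => ?_⟩
    rw [Pi.add_apply, add_mul, hF, hG, eval_add, mul_add]
  smul_mem' := by
    rintro c F ⟨P, hP, hF⟩
    refine ⟨c • P, (natDegree_smul_le c P).trans hP, fun t => ?_⟩
    rw [Pi.smul_apply, smul_mul_assoc, hF, eval_smul, mul_smul_comm]

/-- Since w > 0, each zero of F is a root of Q at z. Injectivity of z over a period makes these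
roots distinct, and there are more of them than deg Q. -/
theorem eq_zero_of_mem_ellipticForms {k : ℝ} (hk : 0 < k) {N : ℕ} {F : ℝ → ℂ}
    (hF : F ∈ ellipticForms k N) {a : ℝ} {S : Finset ℝ}
    (hS : ∀ s ∈ S, F s = 0 ∧ a ≤ s ∧ s < a + 2 * Real.pi) (hcard : 2 * N < S.card) (t : ℝ) :
    F t = 0 := by
  obtain ⟨Q, hQ, h⟩ := hF
  have hQ0 : Q = 0 := by
    apply Polynomial.eq_zero_of_natDegree_lt_card_of_eval_eq_zero' Q (S.image (ellipseDir k))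
    · intro z hz
      obtain ⟨s, hs, rfl⟩ := Finset.mem_image.1 hz
      have := h s
      rw [(hS s hs).1, zero_mul, eq_comm, mul_eq_zero] at this
      refine this.resolve_left (pow_ne_zero _ ?_)
      exact_mod_cast (ellipseRadius_pos hk s).ne'
    · rw [Finset.card_image_of_injOn]
      · omega
      · exact (ellipseDir_injOn hk a).mono fun s hs => (hS s hs).2
  have := h t
  rw [hQ0, Polynomial.eval_zero, mul_zero, mul_eq_zero] at this
  exact this.resolve_right (pow_ne_zero _ (ellipseDir_ne_zero hk t))

theorem ellipseRadius_neg (k t : ℝ) : ellipseRadius k (-t) = ellipseRadius k t := by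
  simp [ellipseRadius]

theorem ellipseDir_neg (k t : ℝ) :
    ellipseDir k (-t) = (starRingEnd ℂ) (ellipseDir k t) := by
  simp [ellipseDir, ellipseRadius_neg, neg_div, -Complex.ofReal_cos, -Complex.ofReal_sin]

/-- Reversing t conjugates z and keeps w. As F is real, conjugating the defining identity gives one
for the reflected function, with conjugate coefficients. -/
theorem comp_neg_mem_ellipticForms {k : ℝ} {N : ℕ} {F : ℝ → ℝ}
    (hF : (fun t => (F t : ℂ)) ∈ ellipticForms k N) :
    (fun t => (F (-t) : ℂ)) ∈ ellipticForms k N := by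
  obtain ⟨Q, hQ, h⟩ := hF
  refine ⟨Q.map (starRingEnd ℂ), Polynomial.natDegree_map_le.trans hQ, fun t => ?_⟩
  have := congrArg (starRingEnd ℂ) (h (-t))
  simp only [map_mul, map_pow, Complex.conj_ofReal, ellipseRadius_neg] at this
  rw [ellipseDir_neg, Complex.conj_conj] at this
  rw [this, ← Complex.conj_conj (ellipseDir k t), Polynomial.eval_map_apply, Complex.conj_conj]

theorem cos_eq_ellipseDir {k : ℝ} (hk : 0 < k) (t : ℝ) :
    (Real.cos t : ℂ) * ellipseDir k t =
      ellipseRadius k t * ((ellipseDir k t ^ 2 + 1) / (2 * k)) := by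
  have h := ellipseDir_mul_conj hk t
  have hk' : (k : ℂ) ≠ 0 := by exact_mod_cast hk.ne'
  have hw : (ellipseRadius k t : ℂ) ≠ 0 := by exact_mod_cast (ellipseRadius_pos hk t).ne'
  have hadd : ellipseDir k t + (starRingEnd ℂ) (ellipseDir k t) =
      2 * (k * Real.cos t / ellipseRadius k t) := by
    rw [Complex.add_conj]
    simp [ellipseDir]
  have hc : (Real.cos t : ℂ) = ellipseRadius k t *
      ((ellipseDir k t + (starRingEnd ℂ) (ellipseDir k t)) / (2 * k)) := by
    rw [hadd]; field_simp
  rw [hc, ← h]; ring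

theorem sin_eq_ellipseDir {k : ℝ} (hk : 0 < k) (t : ℝ) :
    (Real.sin t : ℂ) * Complex.I * ellipseDir k t =
      ellipseRadius k t * ((ellipseDir k t ^ 2 - 1) / 2) := by
  have h := ellipseDir_mul_conj hk t
  have hw : (ellipseRadius k t : ℂ) ≠ 0 := by exact_mod_cast (ellipseRadius_pos hk t).ne'
  have hadd : ellipseDir k t - (starRingEnd ℂ) (ellipseDir k t) =
      2 * (Real.sin t / ellipseRadius k t) * Complex.I := by
    rw [Complex.sub_conj]
    simp [ellipseDir]
  have hc : (Real.sin t : ℂ) * Complex.I = ellipseRadius k t *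
      ((ellipseDir k t - (starRingEnd ℂ) (ellipseDir k t)) / 2) := by
    rw [hadd]; field_simp
  rw [hc, ← h]; ring

-- Both cos t and sin t are w z^(-1) times a quadratic in z, so exp(±it) is a form of degree one and
-- its N-th power is one of degree N.
open Polynomial in
theorem exp_mem_ellipticForms {k : ℝ} (hk : 0 < k) (N : ℕ) (ε : ℂ) (hε : ε = 1 ∨ ε = -1) :
    (fun t : ℝ => Complex.exp (ε * (t * Complex.I)) ^ N) ∈ ellipticForms k N := by
  refine ⟨(C (1 / (2 * k : ℂ)) * (X ^ 2 + 1) + C (ε / 2) * (X ^ 2 - 1)) ^ N, ?_, fun t => ?_⟩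
  · have : (C (1 / (2 * k : ℂ)) * (X ^ 2 + 1) + C (ε / 2) * (X ^ 2 - 1)).natDegree ≤ 2 := by
      compute_degree
    calc _ ≤ N * 2 := natDegree_pow_le_of_le N this
      _ = 2 * N := mul_comm _ _
  · have he : Complex.exp (ε * (t * Complex.I)) =
        Real.cos t + ε * (Real.sin t * Complex.I) := by
      rcases hε with rfl | rfl
      · rw [one_mul, Complex.exp_mul_I]; simp
      · rw [neg_one_mul, ← neg_mul, Complex.exp_mul_I, Complex.cos_neg, Complex.sin_neg]
        push_cast; ring
    rw [← mul_pow, he, add_mul, cos_eq_ellipseDir hk, mul_assoc, sin_eq_ellipseDir hk]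
    simp only [eval_pow, eval_add, eval_mul, eval_C, eval_X, eval_one, eval_sub]
    rw [← mul_pow]
    ring

theorem cos_sub_mem_ellipticForms {k : ℝ} (hk : 0 < k) (N : ℕ) (γ : ℝ) :
    (fun t : ℝ => (Real.cos (N * t - γ) : ℂ)) ∈ ellipticForms k N := by
  have h1 := (ellipticForms k N).smul_mem (Complex.exp (-(γ * Complex.I)) / 2)
    (exp_mem_ellipticForms hk N 1 (Or.inl rfl))
  have h2 := (ellipticForms k N).smul_mem (Complex.exp (γ * Complex.I) / 2)
    (exp_mem_ellipticForms hk N (-1) (Or.inr rfl))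
  convert (ellipticForms k N).add_mem h1 h2 using 1
  funext t
  simp only [Pi.add_apply, Pi.smul_apply, smul_eq_mul, ← Complex.exp_nat_mul]
  rw [div_mul_eq_mul_div, div_mul_eq_mul_div, ← Complex.exp_add, ← Complex.exp_add,
    Complex.ofReal_cos, Complex.cos]
  push_cast
  rw [← add_div]
  congr 3 <;> ring

/-! ### Comparison with a cosine near an extremum, and norming by dense parameters. -/

/-- If F fell below M cos(N(t - τ)), its difference with a perturbed cosine would have 2N + 1 zeros
in one period. The perturbation makes every sign strict, so the tangency at τ needs no count of
multiplicities. -/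
theorem mul_cos_le_of_lt {k : ℝ} (hk : 0 < k) {N : ℕ} (hN : 0 < N) {F : ℝ → ℝ}
    (hFc : Continuous F) (hF : (fun t => (F t : ℂ)) ∈ ellipticForms k N) {M : ℝ} (hM : 0 < M)
    (hFM : ∀ t, |F t| ≤ M) {τ t : ℝ} (hτ : F τ = M) (hτt : τ < t) (ht : N * (t - τ) < Real.pi) :
    M * Real.cos (N * (t - τ)) ≤ F t := by
  by_contra! hlt
  have hN' : (0 : ℝ) < N := by exact_mod_cast hN
  have hpi := Real.pi_pos
  -- a slightly larger and slightly shifted cosine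
  have hcont : Filter.Tendsto
      (fun η : ℝ => M / Real.cos (η / 2) * Real.cos (N * (t - τ) + η)) (nhdsWithin 0 (Set.Ioi 0))
      (nhds (M * Real.cos (N * (t - τ)))) := by
    have : ContinuousAt
        (fun η : ℝ => M / Real.cos (η / 2) * Real.cos (N * (t - τ) + η)) 0 := by
      refine ContinuousAt.mul (ContinuousAt.div (by fun_prop) (by fun_prop) (by simp)) (by fun_prop)
    have h2 := this.tendsto.mono_left (nhdsWithin_le_nhds (s := Set.Ioi 0))
    simpa using h2
  have hev := (hcont.eventually_const_lt hlt).and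
    ((Ioo_mem_nhdsGT (show (0 : ℝ) < Real.pi - N * (t - τ) by linarith)))
  obtain ⟨η, h1, hη0, hη1⟩ := hev.exists
  have hNt : 0 < N * (t - τ) := mul_pos hN' (by linarith)
  have hc2 : 0 < Real.cos (η / 2) := Real.cos_pos_of_mem_Ioo ⟨by linarith, by linarith⟩
  -- For small η > 0 we have cos η < cos(η/2) < 1, so this amplitude satisfies both M < M' and M'
  -- cos η < M.
  set M' := M / Real.cos (η / 2) with hM'
  have hMM' : M < M' := by
    rw [hM', lt_div_iff₀ hc2]
    have : Real.cos (η / 2) < 1 := by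
      rw [← Real.cos_zero]
      exact Real.cos_lt_cos_of_nonneg_of_le_pi le_rfl (by linarith) (by linarith)
    nlinarith
  have hM'c : M' * Real.cos η < M := by
    rw [hM', div_mul_eq_mul_div, div_lt_iff₀ hc2]
    exact mul_lt_mul_of_pos_left
      (Real.cos_lt_cos_of_nonneg_of_le_pi (by linarith) (by linarith) (by linarith)) hM
  set D : ℝ → ℝ := fun s => F s - M' * Real.cos (N * s - (N * τ - η)) with hD
  have hDc : Continuous D := by fun_prop
  have hDform : (fun s => (D s : ℂ)) ∈ ellipticForms k N := by
    convert (ellipticForms k N).sub_mem hF ((ellipticForms k N).smul_mem (M' : ℂ)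
      (cos_sub_mem_ellipticForms hk N (N * τ - η))) using 1
    funext s
    simp [hD]
  -- After τ and t come the extrema of the shifted cosine, where it equals ±M' and dominates F. Up
  -- to index 2N + 1 these are 2N + 2 points with alternating signs, all in [τ, τ + 2π).
  set q : ℕ → ℝ := fun i =>
    if i = 0 then τ else if i = 1 then t else τ - η / N + (i - 1 : ℝ) * Real.pi / N with hq
  have hq0 : q 0 = τ := by simp [hq]
  have hq1 : q 1 = t := by simp [hq]
  have hq2 : ∀ i, q (i + 2) = τ - η / N + (i + 1 : ℝ) * Real.pi / N := by
    intro i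
    simp only [hq, Nat.add_eq_zero_iff, OfNat.ofNat_ne_zero, and_false, if_false]
    rw [if_neg (by omega)]
    push_cast; ring
  have hDτ : D τ = M - M' * Real.cos η := by
    simp only [hD, hτ]; congr 3; ring
  obtain ⟨S, hScard, hS⟩ := exists_finset_zeros_of_alternating hDc (n := 2 * N + 1) (q := q)
    (by
      intro i _
      rcases i with _ | _ | i
      · rw [hq0, zero_add, hq1]; exact hτt
      · rw [zero_add, hq1, show 1 + 1 = 0 + 2 from rfl, hq2]
        have : N * (t - τ) / N < (Real.pi - η) / N := by gcongr; linarith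
        rw [mul_div_cancel_left₀ _ hN'.ne', sub_div] at this
        push_cast
        rw [zero_add, one_mul]
        linarith
      · rw [show i + 1 + 1 + 1 = (i + 1) + 2 from rfl, hq2, hq2]
        push_cast
        gcongr
        linarith)
    (by
      intro i _
      rcases i with _ | _ | i
      · rw [hq0, pow_zero, one_mul, hDτ]; linarith
      · rw [zero_add, hq1, pow_one]
        have : D t = F t - M' * Real.cos (N * (t - τ) + η) := by
          simp only [hD]; congr 3; ring
        rw [this]; linarith
      · rw [hq2]
        have harg : (N : ℝ) * (τ - η / N + (i + 1 : ℝ) * Real.pi / N) - (N * τ - η) =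
            ((i + 1 : ℕ) : ℝ) * Real.pi := by
          field_simp; push_cast; ring
        simp only [hD]
        rw [harg, Real.cos_nat_mul_pi]
        have hb := abs_le.1 (hFM (τ - η / N + (i + 1 : ℝ) * Real.pi / N))
        rcases Nat.even_or_odd i with he | ho
        · have e1 : (-1 : ℝ) ^ (i + 1) = -1 := he.add_one.neg_one_pow
          have e2 : (-1 : ℝ) ^ (i + 1 + 1) = 1 := he.add_one.add_one.neg_one_pow
          rw [e1, e2]; linarith
        · have e1 : (-1 : ℝ) ^ (i + 1) = 1 := ho.add_one.neg_one_pow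
          have e2 : (-1 : ℝ) ^ (i + 1 + 1) = -1 := ho.add_one.add_one.neg_one_pow
          rw [e1, e2]; linarith)
  have hqe : q (2 * N + 1) ≤ τ + 2 * Real.pi := by
    obtain ⟨N', rfl⟩ : ∃ N', N = N' + 1 := ⟨N - 1, by omega⟩
    rw [show 2 * (N' + 1) + 1 = (2 * N' + 1) + 2 from by ring, hq2]
    have e : (((2 * N' + 1 : ℕ) : ℝ) + 1) * Real.pi / ((N' + 1 : ℕ) : ℝ) = 2 * Real.pi := by
      push_cast; field_simp; ring
    rw [e]
    have : 0 < η / ((N' + 1 : ℕ) : ℝ) := by positivity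
    linarith
  have hzero := eq_zero_of_mem_ellipticForms hk hDform (a := τ) (S := S)
    (fun s hs => ⟨by simp [(hS s hs).1], by have := (hS s hs).2.1; rw [hq0] at this; exact this.le,
      (hS s hs).2.2.trans_le hqe⟩) (by omega) τ
  have : D τ = 0 := by exact_mod_cast hzero
  linarith

/-- A form of degree `N` decreases from an extremum at most as fast as a cosine of frequency `N`. -/
theorem abs_mul_cos_le {k : ℝ} (hk : 0 < k) {N : ℕ} (hN : 0 < N) {F : ℝ → ℝ}
    (hFc : Continuous F) (hF : (fun t => (F t : ℂ)) ∈ ellipticForms k N) {τ : ℝ}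
    (hτ : ∀ t, |F t| ≤ |F τ|) {t ρ : ℝ} (ht : N * |t - τ| ≤ ρ) (hρ : ρ < Real.pi / 2) :
    |F τ| * Real.cos ρ ≤ |F t| := by
  have hN' : (0 : ℝ) < N := by exact_mod_cast hN
  have hpi := Real.pi_pos
  rcases (abs_nonneg (F τ)).eq_or_lt with h0 | h0
  · rw [← h0, zero_mul]; exact abs_nonneg _
  have key : ∀ G : ℝ → ℝ, Continuous G → (fun t => (G t : ℂ)) ∈ ellipticForms k N →
      (∀ t, |G t| ≤ |F τ|) → G τ = |F τ| → |F τ| * Real.cos ρ ≤ G t := by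
    intro G hGc hG hGM hGτ
    have hcos : |F τ| * Real.cos ρ ≤ |F τ| * Real.cos (N * |t - τ|) :=
      mul_le_mul_of_nonneg_left (Real.cos_le_cos_of_nonneg_of_le_pi (by positivity) (by linarith) ht)
        h0.le
    refine hcos.trans ?_
    rcases lt_trichotomy τ t with h | h | h
    · rw [abs_of_pos (a := t - τ) (by linarith)] at ht ⊢
      exact mul_cos_le_of_lt hk hN hGc hG h0 hGM hGτ h (by linarith)
    · rw [← h, hGτ]; simp
    · rw [abs_of_neg (a := t - τ) (by linarith)] at ht ⊢
      have := mul_cos_le_of_lt hk hN (F := fun s => G (-s)) (by fun_prop)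
        (comp_neg_mem_ellipticForms hG) h0 (fun t => hGM _) (τ := -τ) (t := -t) (by simpa using hGτ)
        (by linarith) (by linarith)
      rw [neg_neg] at this
      rwa [show -(t - τ) = -t - -τ by ring]
  rcases le_total 0 (F τ) with h | h
  · exact (key F hFc hF hτ (abs_of_nonneg h).symm).trans (le_abs_self _)
  · refine (key (fun s => -F s) (by fun_prop) ?_ (by simpa using hτ)
      (abs_of_nonpos h).symm).trans (neg_le_abs _)
    convert (ellipticForms k N).neg_mem hF using 1
    funext s
    simp

theorem eq_of_mem_ellipticForms_zero {k : ℝ} {F : ℝ → ℝ}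
    (hF : (fun t => (F t : ℂ)) ∈ ellipticForms k 0) (s t : ℝ) : F s = F t := by
  obtain ⟨Q, hQ, h⟩ := hF
  rw [Polynomial.eq_C_of_natDegree_le_zero hQ] at h
  have hs := h s
  have ht := h t
  simp only [pow_zero, mul_one, one_mul, Polynomial.eval_C] at hs ht
  exact_mod_cast hs.trans ht.symm

theorem cos_pi_div_two_mul_pos {m : ℝ} (hm : 1 < m) : 0 < Real.cos (Real.pi / (2 * m)) := by
  have hpi := Real.pi_pos
  refine Real.cos_pos_of_mem_Ioo ⟨?_, ?_⟩
  · have : 0 < Real.pi / (2 * m) := by positivity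
    linarith
  · exact div_lt_div_of_pos_left hpi (by norm_num) (by linarith)

/-- A form of degree `N` is normed by any set that is dense enough in the parameter. -/
theorem abs_le_of_mem_ellipticForms {k : ℝ} (hk : 0 < k) {N : ℕ} {F : ℝ → ℝ}
    (hFc : Continuous F) (hF : (fun t => (F t : ℂ)) ∈ ellipticForms k N) {m B : ℝ} (hm : 1 < m)
    (hfold : ∀ t, ∃ t' ∈ Set.Icc 0 Real.pi, F t = F t')
    (hB : ∀ t ∈ Set.Icc 0 Real.pi, ∃ s, N * |s - t| ≤ Real.pi / (2 * m) ∧ |F s| ≤ B) (t : ℝ) :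
    |F t| ≤ 1 / Real.cos (Real.pi / (2 * m)) * B := by
  have hpi := Real.pi_pos
  have hcos := cos_pi_div_two_mul_pos hm
  obtain ⟨τ, hτ, hmax⟩ := isCompact_Icc.exists_isMaxOn (Set.nonempty_Icc.2 hpi.le)
    (f := fun t => |F t|) (by fun_prop)
  have hmax' : ∀ t, |F t| ≤ |F τ| := by
    -- The folding hypothesis makes the maximum over [0, π] a global one, as the comparison
    -- requires.
    intro t
    obtain ⟨t', ht', h⟩ := hfold t
    rw [h]
    exact hmax ht'
  obtain ⟨s, hs, hsB⟩ := hB τ hτ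
  refine (hmax' t).trans ?_
  rw [one_div_mul_eq_div, le_div_iff₀ hcos]
  refine le_trans ?_ hsB
  rcases Nat.eq_zero_or_pos N with rfl | hN
  · rw [eq_of_mem_ellipticForms_zero hF s τ]
    exact mul_le_of_le_one_right (abs_nonneg _) (Real.cos_le_one _)
  · exact abs_mul_cos_le hk hN hFc hF hmax' hs
      (div_lt_div_of_pos_left hpi (by norm_num) (by linarith))

/-! ### Substitutions that turn polynomials into forms. -/

theorem ellipseRadius_one (t : ℝ) : ellipseRadius 1 t = 1 := by
  simp [ellipseRadius]

theorem ellipseDir_one (t : ℝ) : ellipseDir 1 t = Complex.exp (t * Complex.I) := by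
  rw [Complex.exp_mul_I]
  simp [ellipseDir, ellipseRadius_one]

theorem continuous_of_mem_algSpace {n : ℕ} {f : ℝ → ℝ} (hf : f ∈ algSpace n) : Continuous f := by
  induction hf using Submodule.span_induction with
  | mem f h => obtain ⟨k, -, rfl⟩ := h; fun_prop
  | zero => exact continuous_zero
  | add f g _ _ hf hg => exact hf.add hg
  | smul c f _ hf => exact hf.const_smul c

theorem continuous_of_mem_trigSpace {n : ℕ} {f : ℝ → ℝ} (hf : f ∈ trigSpace n) :
    Continuous f := by
  induction hf using Submodule.span_induction with
  | mem f h => obtain ⟨k, -, rfl | rfl⟩ := h <;> fun_prop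
  | zero => exact continuous_zero
  | add f g _ _ hf hg => exact hf.add hg
  | smul c f _ hf => exact hf.const_smul c

theorem periodic_of_mem_trigSpace {n : ℕ} {f : ℝ → ℝ} (hf : f ∈ trigSpace n) :
    Function.Periodic f (2 * Real.pi) := by
  induction hf using Submodule.span_induction with
  | mem f h =>
    obtain ⟨k, -, rfl | rfl⟩ := h
    · intro x
      simp only [mul_add]
      exact Real.cos_add_nat_mul_two_pi _ k
    · intro x
      simp only [mul_add]
      exact Real.sin_add_nat_mul_two_pi _ k
  | zero => intro x; rfl
  | add f g _ _ hf hg => exact hf.add hg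
  | smul c f _ hf => exact hf.smul c

open Polynomial in
theorem comp_cos_mem_ellipticForms {n : ℕ} {f : ℝ → ℝ} (hf : f ∈ algSpace n) (A B : ℝ) :
    (fun t => (f (A * Real.cos t + B) : ℂ)) ∈ ellipticForms 1 n := by
  induction hf using Submodule.span_induction with
  | mem f h =>
    obtain ⟨j, hj, rfl⟩ := h
    -- On the circle w = 1, so a lower degree is raised to n simply by a power of z.
    refine ⟨X ^ (n - j) * (C (A / 2 : ℂ) * (X ^ 2 + 1) + C (B : ℂ) * X) ^ j, ?_, fun t => ?_⟩
    · have h1 : (X ^ (n - j) : ℂ[X]).natDegree ≤ n - j := natDegree_X_pow_le _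
      have h2 : (C (A / 2 : ℂ) * (X ^ 2 + 1) + C (B : ℂ) * X).natDegree ≤ 2 := by
        compute_degree
      refine (natDegree_mul_le_of_le h1 (natDegree_pow_le_of_le j h2)).trans ?_
      omega
    · have h := cos_eq_ellipseDir one_pos t
      rw [ellipseRadius_one] at h ⊢
      have hn : ellipseDir 1 t ^ n = ellipseDir 1 t ^ (n - j) * ellipseDir 1 t ^ j := by
        rw [← pow_add, Nat.sub_add_cancel hj]
      simp only [eval_mul, eval_pow, eval_X, eval_add, eval_C, eval_one, Complex.ofReal_pow,
        Complex.ofReal_add, Complex.ofReal_mul]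
      rw [hn, Complex.ofReal_one, one_pow, one_mul, mul_left_comm, ← mul_pow]
      congr 2
      push_cast at h ⊢
      linear_combination (A : ℂ) * h
  | zero =>
    convert (ellipticForms 1 n).zero_mem using 1
    funext t; simp
  | add f g _ _ hf hg =>
    convert (ellipticForms 1 n).add_mem hf hg using 1
    funext t; simp
  | smul c f _ hf =>
    convert (ellipticForms 1 n).smul_mem (c : ℂ) hf using 1
    funext t; simp

theorem comp_mem_ellipticForms_of_exp {k : ℝ} {N n : ℕ} {Θ : ℝ → ℝ}
    (hΘ : ∀ j ≤ n, ∀ ε : ℂ, ε = 1 ∨ ε = -1 →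
      (fun t : ℝ => Complex.exp (ε * (Θ t * Complex.I)) ^ j) ∈ ellipticForms k N)
    {f : ℝ → ℝ} (hf : f ∈ trigSpace n) (c : ℝ) :
    (fun t => (f (Θ t + c) : ℂ)) ∈ ellipticForms k N := by
  induction hf using Submodule.span_induction with
  | mem f h =>
    obtain ⟨j, hj, rfl | rfl⟩ := h
    · convert (ellipticForms k N).add_mem
        ((ellipticForms k N).smul_mem (Complex.exp (j * c * Complex.I) / 2)
          (hΘ j hj 1 (Or.inl rfl)))
        ((ellipticForms k N).smul_mem (Complex.exp (-(j * c * Complex.I)) / 2)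
          (hΘ j hj (-1) (Or.inr rfl))) using 1
      funext t
      simp only [Pi.add_apply, Pi.smul_apply, smul_eq_mul, ← Complex.exp_nat_mul]
      rw [div_mul_eq_mul_div, div_mul_eq_mul_div, ← Complex.exp_add, ← Complex.exp_add,
        Complex.ofReal_cos, Complex.cos]
      push_cast
      rw [← add_div]
      congr 3 <;> ring
    · convert (ellipticForms k N).add_mem
        ((ellipticForms k N).smul_mem (-(Complex.exp (j * c * Complex.I) * Complex.I / 2))
          (hΘ j hj 1 (Or.inl rfl)))
        ((ellipticForms k N).smul_mem (Complex.exp (-(j * c * Complex.I)) * Complex.I / 2)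
          (hΘ j hj (-1) (Or.inr rfl))) using 1
      funext t
      simp only [Pi.add_apply, Pi.smul_apply, smul_eq_mul, ← Complex.exp_nat_mul]
      rw [Complex.ofReal_sin, Complex.sin]
      push_cast
      rw [show -((j : ℂ) * (Θ t + c)) * Complex.I =
        -(j * c * Complex.I) + j * (-1 * (Θ t * Complex.I)) by ring,
        show ((j : ℂ) * (Θ t + c)) * Complex.I =
        (j * c * Complex.I) + j * (1 * (Θ t * Complex.I)) by ring, Complex.exp_add, Complex.exp_add]
      ring
  | zero =>
    convert (ellipticForms k N).zero_mem using 1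
    funext t; simp
  | add f g _ _ hf hg =>
    convert (ellipticForms k N).add_mem hf hg using 1
    funext t; simp
  | smul c f _ hf =>
    convert (ellipticForms k N).smul_mem (c : ℂ) hf using 1
    funext t; simp

open Polynomial in
theorem exp_pi_sub_two_mul_mem_ellipticForms {n j : ℕ} (hj : j ≤ n) {ε : ℂ}
    (hε : ε = 1 ∨ ε = -1) :
    (fun t : ℝ => Complex.exp (ε * ((Real.pi - 2 * t : ℝ) * Complex.I)) ^ j) ∈
      ellipticForms 1 (2 * n) := by
  rcases hε with rfl | rfl
  · refine ⟨C (Complex.exp (Real.pi * Complex.I) ^ j) * X ^ (2 * n - 2 * j), ?_, fun t => ?_⟩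
    · exact (natDegree_C_mul_X_pow_le _ _).trans (by omega)
    · rw [ellipseRadius_one, ellipseDir_one]
      have he : Complex.exp (1 * ((Real.pi - 2 * t : ℝ) * Complex.I)) *
          Complex.exp (t * Complex.I) ^ 2 = Complex.exp (Real.pi * Complex.I) := by
        rw [← Complex.exp_nat_mul, ← Complex.exp_add]
        congr 1
        push_cast
        ring
      have hn : Complex.exp (t * Complex.I) ^ (2 * n) =
          Complex.exp (t * Complex.I) ^ (2 * n - 2 * j) *
            (Complex.exp (t * Complex.I) ^ 2) ^ j := by
        rw [← pow_mul, ← pow_add, Nat.sub_add_cancel (by omega)]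
      simp only [eval_mul, eval_C, eval_pow, eval_X]
      rw [hn, ← he, mul_pow, Complex.ofReal_one, one_pow]
      ring
  · refine ⟨C (Complex.exp (-(Real.pi * Complex.I)) ^ j) * X ^ (2 * n + 2 * j), ?_, fun t => ?_⟩
    · exact (natDegree_C_mul_X_pow_le _ _).trans (by omega)
    · rw [ellipseRadius_one, ellipseDir_one]
      have he : Complex.exp (-1 * ((Real.pi - 2 * t : ℝ) * Complex.I)) =
          Complex.exp (-(Real.pi * Complex.I)) * Complex.exp (t * Complex.I) ^ 2 := by
        rw [← Complex.exp_nat_mul, ← Complex.exp_add]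
        congr 1
        push_cast
        ring
      simp only [eval_mul, eval_C, eval_pow, eval_X]
      rw [he, mul_pow, Complex.ofReal_one, one_pow]
      ring

theorem ellipseRadius_cos (η t : ℝ) :
    ellipseRadius (Real.cos η) t = √(1 - (Real.sin η * Real.cos t) ^ 2) := by
  rw [ellipseRadius]
  congr 1
  have h1 := Real.sin_sq_add_cos_sq t
  have h2 := Real.sin_sq_add_cos_sq η
  linear_combination h1 + Real.cos t ^ 2 * h2

theorem abs_sin_mul_le_one (η : ℝ) {s : ℝ} (hs : |s| ≤ 1) : |Real.sin η * s| ≤ 1 := by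
  rw [abs_mul]
  exact mul_le_one₀ (Real.abs_sin_le_one η) (abs_nonneg _) hs

-- With c = sin(ω/2), the sine of ψ/2 is c cos t and its cosine is √(1 - c² cos² t), which is
-- exactly the radius w of the ellipse with k = cos(ω/2). So exp(±iψ) = (w ± ic cos t)² is a form of
-- degree two.
open Polynomial in
theorem exp_psi_cos_mem_ellipticForms {ω : ℝ} (hω : 0 < Real.cos (ω / 2)) {n j : ℕ} (hj : j ≤ n)
    {ε : ℂ} (hε : ε = 1 ∨ ε = -1) :
    (fun t : ℝ => Complex.exp (ε * (psi ω (Real.cos t) * Complex.I)) ^ j) ∈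
      ellipticForms (Real.cos (ω / 2)) (2 * n) := by
  set k := Real.cos (ω / 2) with hkdef
  set c := Real.sin (ω / 2) with hcdef
  set Y : ℂ[X] := C (c / (2 * k) : ℂ) * (X ^ 2 + 1) with hY
  have hYdeg : Y.natDegree ≤ 2 := by rw [hY]; compute_degree
  -- In terms of z, X stands for w and Y for c cos t, up to the common factor w/z. The second factor
  -- encodes 1 = w² + c² cos² t and raises the degree from 2j to 2n.
  refine ⟨(X + C (ε * Complex.I) * Y) ^ (2 * j) * (X ^ 2 + Y ^ 2) ^ (n - j), ?_, fun t => ?_⟩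
  · have h1 : (X + C (ε * Complex.I) * Y).natDegree ≤ 2 :=
      natDegree_add_le_of_degree_le (natDegree_X_le.trans (by norm_num))
        ((natDegree_C_mul_le _ _).trans hYdeg)
    have h2 : (X ^ 2 + Y ^ 2).natDegree ≤ 4 :=
      natDegree_add_le_of_degree_le ((natDegree_X_pow_le 2).trans (by norm_num))
        (natDegree_pow_le_of_le 2 hYdeg)
    refine (natDegree_mul_le_of_le (natDegree_pow_le_of_le _ h1)
      (natDegree_pow_le_of_le _ h2)).trans ?_
    omega
  · have hct : |c * Real.cos t| ≤ 1 := abs_sin_mul_le_one _ (Real.abs_cos_le_one t)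
    have hle := abs_le.1 hct
    set w := ellipseRadius k t with hw
    set z := ellipseDir k t with hz
    have hwsq : (w : ℂ) ^ 2 + (c * Real.cos t : ℂ) ^ 2 = 1 := by
      have : w ^ 2 + (c * Real.cos t) ^ 2 = 1 := by
        rw [hw, hkdef, ellipseRadius_cos, Real.sq_sqrt]
        · ring
        · have := sq_le_one_iff_abs_le_one (c * Real.cos t) |>.2 hct
          linarith
      exact_mod_cast this
    have hexp : Complex.exp (ε * (psi ω (Real.cos t) * Complex.I)) =
        (w + ε * Complex.I * (c * Real.cos t)) ^ 2 := by
      rw [psi]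
      set φ := Real.arcsin (Real.sin (ω / 2) * Real.cos t) with hφ
      have hs : Real.sin φ = c * Real.cos t := Real.sin_arcsin hle.1 hle.2
      have hc : Real.cos φ = w := by
        rw [hφ, Real.cos_arcsin, hw, hkdef, ellipseRadius_cos]
      have e : Complex.exp (ε * (φ * Complex.I)) = Real.cos φ + ε * Complex.I * Real.sin φ := by
        rcases hε with rfl | rfl
        · rw [one_mul, Complex.exp_mul_I]; push_cast; ring
        · rw [neg_one_mul, ← neg_mul, Complex.exp_mul_I, Complex.cos_neg, Complex.sin_neg]
          push_cast; ring
      rw [hc, hs] at e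
      push_cast at e ⊢
      rw [← e, ← Complex.exp_nat_mul]
      congr 1
      push_cast
      ring
    have hYe : w * Y.eval z = c * Real.cos t * z := by
      have h := cos_eq_ellipseDir hω t
      simp only [hY, eval_mul, eval_C, eval_add, eval_pow, eval_X, eval_one]
      rw [mul_assoc, h]
      ring
    have h1 : (w + ε * Complex.I * (c * Real.cos t)) * z =
        w * (z + ε * Complex.I * Y.eval z) := by
      linear_combination -(ε * Complex.I) * hYe
    have h2 : z ^ 2 = (w : ℂ) ^ 2 * (z ^ 2 + Y.eval z ^ 2) := by
      linear_combination (-z ^ 2) * hwsq - (w * Y.eval z + c * Real.cos t * z) * hYe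
    have hn : 2 * n = 2 * j + 2 * (n - j) := by omega
    simp only [eval_mul, eval_pow, eval_add, eval_X, eval_C]
    calc _ = ((w + ε * Complex.I * (c * Real.cos t)) * z) ^ (2 * j) * (z ^ 2) ^ (n - j) := by
          rw [hexp, mul_pow _ z, ← pow_mul, ← pow_mul z, hn, pow_add]
          ring
      _ = (w * (z + ε * Complex.I * Y.eval z)) ^ (2 * j) *
          ((w : ℂ) ^ 2 * (z ^ 2 + Y.eval z ^ 2)) ^ (n - j) := by rw [h1, ← h2]
      _ = _ := by
          rw [mul_pow, mul_pow, ← pow_mul, hn, pow_add (w : ℂ)]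
          ring

/-! ### Spacing of the nodes and the univariate norming inequalities. -/

theorem exists_nat_mul_pi_div_near {k : ℕ} (hk : 0 < k) {t : ℝ} (ht : t ∈ Set.Icc 0 Real.pi) :
    ∃ j ≤ k, |(j : ℝ) * Real.pi / k - t| ≤ Real.pi / (2 * k) := by
  have hpi := Real.pi_pos
  have hk' : (0 : ℝ) < k := by exact_mod_cast hk
  set x := t * k / Real.pi with hx
  have hx0 : 0 ≤ x := by have := ht.1; positivity
  have hxk : x ≤ k := by
    rw [hx, div_le_iff₀ hpi, mul_comm (k : ℝ)]
    exact mul_le_mul_of_nonneg_right ht.2 hk'.le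
  refine ⟨⌊x + 1 / 2⌋₊, ?_, ?_⟩
  · rw [← Nat.lt_succ_iff, Nat.floor_lt (by positivity)]
    push_cast
    linarith
  · have h1 := Nat.floor_le (show 0 ≤ x + 1 / 2 by positivity)
    have h2 := Nat.lt_floor_add_one (x + 1 / 2)
    have ht' : t = x * Real.pi / k := by rw [hx]; field_simp
    rw [ht', ← sub_div, ← sub_mul, abs_div, abs_mul, abs_of_pos hpi, abs_of_pos hk',
      div_le_div_iff₀ hk' (by positivity)]
    have h3 : |(⌊x + 1 / 2⌋₊ : ℝ) - x| ≤ 1 / 2 := abs_le.2 ⟨by linarith, by linarith⟩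
    calc _ ≤ 1 / 2 * Real.pi * (2 * k) := by gcongr
      _ = _ := by ring

theorem exists_odd_mul_pi_div_near (k : ℕ) {t : ℝ} (ht : t ∈ Set.Icc 0 Real.pi) :
    ∃ j ≤ k, |(2 * j + 1 : ℝ) * Real.pi / (2 * (k + 1)) - t| ≤ Real.pi / (2 * (k + 1)) := by
  have hpi := Real.pi_pos
  have hk' : (0 : ℝ) < k + 1 := by positivity
  set x := t * (k + 1) / Real.pi with hx
  have hx0 : 0 ≤ x := by have := ht.1; positivity
  have hxk : x ≤ k + 1 := by
    rw [hx, div_le_iff₀ hpi, mul_comm (k + 1 : ℝ)]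
    exact mul_le_mul_of_nonneg_right ht.2 hk'.le
  have hj : ∃ j ≤ k, (j : ℝ) ≤ x ∧ x ≤ j + 1 := by
    rcases le_or_gt ⌊x⌋₊ k with h | h
    · exact ⟨_, h, Nat.floor_le hx0, (Nat.lt_floor_add_one x).le⟩
    -- Only the endpoint t = π lands here: the floor is k + 1 and the last cell is used instead.
    · refine ⟨k, le_rfl, ?_, hxk⟩
      have : (k : ℝ) ≤ ⌊x⌋₊ := by exact_mod_cast h.le
      exact this.trans (Nat.floor_le hx0)
  obtain ⟨j, hjk, h1, h2⟩ := hj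
  refine ⟨j, hjk, ?_⟩
  have ht' : t = 2 * x * Real.pi / (2 * (k + 1)) := by rw [hx]; field_simp
  rw [ht', ← sub_div, ← sub_mul, abs_div, abs_mul, abs_of_pos hpi,
    abs_of_pos (show (0 : ℝ) < 2 * (k + 1) by positivity)]
  have h3 : |(2 * j + 1 : ℝ) - 2 * x| ≤ 1 := abs_le.2 ⟨by linarith, by linarith⟩
  gcongr
  exact mul_le_of_le_one_left hpi.le h3

theorem nat_mul_le_pi_div {N : ℕ} {m x K : ℝ} (hm : 0 < m) (hK : 0 < K)
    (hNK : m * N ≤ K) (hx : x ≤ Real.pi / (2 * K)) : N * x ≤ Real.pi / (2 * m) := by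
  have hpi := Real.pi_pos
  calc N * x ≤ N * (Real.pi / (2 * K)) := by gcongr
    _ = (m * N) * (Real.pi / (2 * K * m)) := by field_simp
    _ ≤ K * (Real.pi / (2 * K * m)) := by gcongr
    _ = _ := by field_simp

theorem exists_cos_eq_of_mem_Icc {a b x : ℝ} (hx : x ∈ Set.Icc a b) :
    ∃ t ∈ Set.Icc 0 Real.pi, (b - a) / 2 * Real.cos t + (b + a) / 2 = x := by
  have h := intermediate_value_Icc' Real.pi_pos.le
    (f := fun t => (b - a) / 2 * Real.cos t + (b + a) / 2) (by fun_prop)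
  apply h
  simp only [Real.cos_pi, Real.cos_zero]
  exact ⟨by linarith [hx.1], by linarith [hx.2]⟩

theorem exists_mem_Icc_cos_eq (t : ℝ) : ∃ t' ∈ Set.Icc 0 Real.pi, Real.cos t = Real.cos t' :=
  ⟨Real.arccos (Real.cos t), ⟨Real.arccos_nonneg _, Real.arccos_le_pi _⟩,
    (Real.cos_arccos (Real.neg_one_le_cos t) (Real.cos_le_one t)).symm⟩

/-- The Chebyshev-Lobatto nodes norm the algebraic polynomials. -/
theorem abs_le_of_lobattoNodes {n : ℕ} {f : ℝ → ℝ} (hf : f ∈ algSpace n) {a b m B : ℝ}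
    (hm : 1 < m) (hB : ∀ s ∈ lobattoNodes (m * n) a b, |f s| ≤ B) {x : ℝ}
    (hx : x ∈ Set.Icc a b) : |f x| ≤ 1 / Real.cos (Real.pi / (2 * m)) * B := by
  have hfc := continuous_of_mem_algSpace hf
  obtain ⟨t, -, rfl⟩ := exists_cos_eq_of_mem_Icc hx
  refine abs_le_of_mem_ellipticForms one_pos
    (F := fun t => f ((b - a) / 2 * Real.cos t + (b + a) / 2)) (by fun_prop)
    (comp_cos_mem_ellipticForms hf _ _) hm ?_ ?_ t
  · intro t
    obtain ⟨t', ht', h⟩ := exists_mem_Icc_cos_eq t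
    exact ⟨t', ht', by simp only [h]⟩
  · intro t ht
    have hmem : ∀ j ≤ ⌈m * n⌉₊, |f ((b - a) / 2 * Real.cos (j * Real.pi / (⌈m * n⌉₊ : ℝ)) +
        (b + a) / 2)| ≤ B := fun j hj =>
      hB _ (Finset.mem_image.2 ⟨j, Finset.mem_range.2 (by omega), rfl⟩)
    -- For n = 0 the spacing condition is void and the node with j = 0 serves.
    rcases Nat.eq_zero_or_pos n with rfl | hn
    · exact ⟨_, by rw [Nat.cast_zero, zero_mul]; have := Real.pi_pos; positivity,
        hmem 0 (Nat.zero_le _)⟩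
    · have hn' : (0 : ℝ) < n := by exact_mod_cast hn
      have hk : 0 < ⌈m * n⌉₊ := Nat.ceil_pos.2 (by positivity)
      obtain ⟨j, hj, hd⟩ := exists_nat_mul_pi_div_near hk ht
      exact ⟨_, nat_mul_le_pi_div (by linarith) (by exact_mod_cast hk) (Nat.le_ceil _) hd,
        hmem j hj⟩

theorem psi_mem_Icc {ω : ℝ} (h0 : 0 ≤ ω) (hpi : ω ≤ Real.pi) {s : ℝ} (hs : |s| ≤ 1) :
    psi ω s ∈ Set.Icc (-ω) ω := by
  have hsin : 0 ≤ Real.sin (ω / 2) := Real.sin_nonneg_of_nonneg_of_le_pi (by linarith) (by linarith)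
  have hs' := abs_le.1 hs
  have e1 : Real.arcsin (Real.sin (ω / 2)) = ω / 2 := Real.arcsin_sin (by linarith) (by linarith)
  have e2 : Real.arcsin (Real.sin (ω / 2) * s) ≤ ω / 2 := by
    rw [← e1]
    refine Real.monotone_arcsin ?_
    rw [e1]
    exact mul_le_of_le_one_right hsin hs'.2
  have e3 : -(ω / 2) ≤ Real.arcsin (Real.sin (ω / 2) * s) := by
    rw [← e1, ← Real.arcsin_neg]
    refine Real.monotone_arcsin ?_
    rw [e1]
    nlinarith
  exact ⟨by rw [psi]; linarith, by rw [psi]; linarith⟩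

theorem exists_psi_cos_eq_of_mem_Icc {u v x : ℝ} (hper : v - u ≤ 2 * Real.pi)
    (hx : x ∈ Set.Icc u v) :
    ∃ t ∈ Set.Icc 0 Real.pi, psi ((v - u) / 2) (Real.cos t) + (u + v) / 2 = x := by
  have huv : u ≤ v := hx.1.trans hx.2
  have hpi := Real.pi_pos
  have h := intermediate_value_Icc' hpi.le
    (f := fun t => psi ((v - u) / 2) (Real.cos t) + (u + v) / 2)
    (by unfold psi; fun_prop)
  apply h
  have e1 : Real.arcsin (Real.sin ((v - u) / 2 / 2)) = (v - u) / 2 / 2 :=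
    Real.arcsin_sin (by linarith) (by linarith)
  simp only [psi, Real.cos_pi, Real.cos_zero, mul_one, mul_neg, Real.arcsin_neg, e1]
  exact ⟨by linarith [hx.1], by linarith [hx.2]⟩

theorem psi_pi_cos {t : ℝ} (ht : t ∈ Set.Icc 0 Real.pi) :
    psi Real.pi (Real.cos t) = Real.pi - 2 * t := by
  rw [psi, Real.sin_pi_div_two, one_mul, Real.arcsin_eq_pi_div_two_sub_arccos,
    Real.arccos_cos ht.1 ht.2]
  ring

/-- The angular nodes norm the trigonometric polynomials on intervals of length at most `2 * π`. -/
theorem abs_le_of_angularNodes {n : ℕ} {f : ℝ → ℝ} (hf : f ∈ trigSpace n) {u v m B : ℝ}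
    (hper : v - u ≤ 2 * Real.pi)
    (hm : 1 < m) (hB : ∀ s ∈ angularNodes (m * n) u v, |f s| ≤ B) {x : ℝ}
    (hx : x ∈ Set.Icc u v) : |f x| ≤ 1 / Real.cos (Real.pi / (2 * m)) * B := by
  have hpi := Real.pi_pos
  have huv : u ≤ v := hx.1.trans hx.2
  have hfc := continuous_of_mem_trigSpace hf
  have hnode : ∀ t ∈ Set.Icc 0 Real.pi, ∃ s ∈ Set.Icc 0 Real.pi,
      ((2 * n : ℕ) : ℝ) * |s - t| ≤ Real.pi / (2 * m) ∧
        |f (psi ((v - u) / 2) (Real.cos s) + (u + v) / 2)| ≤ B := by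
    intro t ht
    set k := ⌈2 * (m * n)⌉₊ with hk
    obtain ⟨j, hj, hd⟩ := exists_odd_mul_pi_div_near k ht
    have hj' : (j : ℝ) ≤ k := by exact_mod_cast hj
    refine ⟨(2 * j + 1 : ℝ) * Real.pi / (2 * (k + 1)), ⟨by positivity, ?_⟩, ?_, ?_⟩
    · rw [div_le_iff₀ (by positivity), mul_comm]
      gcongr
      linarith
    · refine nat_mul_le_pi_div (by linarith) (by positivity) ?_ hd
      have := Nat.le_ceil (2 * (m * n))
      push_cast
      linarith
    · exact hB _ (Finset.mem_image.2 ⟨_, Finset.mem_image.2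
        ⟨j, Finset.mem_range.2 (by omega), rfl⟩, rfl⟩)
  obtain ⟨t, ht, rfl⟩ := exists_psi_cos_eq_of_mem_Icc hper hx
  -- For a full period k = cos(π/2) = 0 and the ellipse degenerates. There ψ_π(cos t) = π - 2t on
  -- [0, π], and this linear expression is used for all t on the circle; f, being 2π-periodic,
  -- becomes π-periodic in t, which replaces the symmetry of cos t in the folding hypothesis.
  rcases hper.eq_or_lt with h | h
  · have hω : (v - u) / 2 = Real.pi := by linarith
    rw [hω] at hnode ⊢
    rw [psi_pi_cos ht]
    refine abs_le_of_mem_ellipticForms one_pos (N := 2 * n)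
      (F := fun t => f (Real.pi - 2 * t + (u + v) / 2)) (by fun_prop)
      (comp_mem_ellipticForms_of_exp
        (fun j hj ε hε => exp_pi_sub_two_mul_mem_ellipticForms hj hε) hf _) hm ?_ ?_ t
    · have hp : Function.Periodic (fun t => f (Real.pi - 2 * t + (u + v) / 2)) Real.pi := by
        intro t
        have := periodic_of_mem_trigSpace hf (Real.pi - 2 * (t + Real.pi) + (u + v) / 2)
        simp only
        rw [← this]
        congr 1
        ring
      intro t
      obtain ⟨t', ht', he⟩ := hp.exists_mem_Ico hpi t 0
      exact ⟨t', ⟨ht'.1, by linarith [ht'.2]⟩, he⟩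
    · intro t ht
      obtain ⟨s, hs, h1, h2⟩ := hnode t ht
      rw [psi_pi_cos hs] at h2
      exact ⟨s, h1, h2⟩
  · have hcos : 0 < Real.cos ((v - u) / 2 / 2) :=
      Real.cos_pos_of_mem_Ioo ⟨by linarith, by linarith⟩
    refine abs_le_of_mem_ellipticForms hcos (N := 2 * n)
      (F := fun t => f (psi ((v - u) / 2) (Real.cos t) + (u + v) / 2))
      (by unfold psi; fun_prop)
      (comp_mem_ellipticForms_of_exp
        (fun j hj ε hε => exp_psi_cos_mem_ellipticForms hcos hj hε) hf _) hm ?_ ?_ t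
    · intro t
      obtain ⟨t', ht', h⟩ := exists_mem_Icc_cos_eq t
      exact ⟨t', ht', by simp only [h]⟩
    · intro t ht
      obtain ⟨s, -, h1, h2⟩ := hnode t ht
      exact ⟨s, h1, h2⟩

/-- The cosine lies above its chord 1 - 2x/π on [0, π/2]; at x = π/(2m) the chord has height (m -
1)/m. -/
theorem one_div_cos_le {m : ℝ} (hm : 1 < m) :
    1 / Real.cos (Real.pi / (2 * m)) ≤ m / (m - 1) := by
  have hpi := Real.pi_pos
  have hm0 : 0 < m - 1 := by linarith
  have h := Real.one_sub_mul_le_cos (x := Real.pi / (2 * m)) (by positivity)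
    (div_le_div_of_nonneg_left hpi.le (by norm_num) (by linarith))
  have e : 1 - 2 / Real.pi * (Real.pi / (2 * m)) = (m - 1) / m := by
    field_simp
  rw [e] at h
  calc 1 / Real.cos (Real.pi / (2 * m)) ≤ 1 / ((m - 1) / m) :=
        one_div_le_one_div_of_le (by positivity) h
    _ = _ := one_div_div _ _

/-! ### From one variable to several: degrees under composition, and tensorization. -/

/-- A filtration of the algebra of real functions by subspaces, compatible with products. -/
structure IsDegreeFiltration (V : ℕ → Submodule ℝ (ℝ → ℝ)) : Prop where
  mono : Monotone V
  one_mem : 1 ∈ V 0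
  mul_mem : ∀ {i j : ℕ} {f g : ℝ → ℝ}, f ∈ V i → g ∈ V j → f * g ∈ V (i + j)

namespace IsDegreeFiltration

variable {V : ℕ → Submodule ℝ (ℝ → ℝ)}

theorem pow_mem (hV : IsDegreeFiltration V) {f : ℝ → ℝ} (hf : f ∈ V 1) (k : ℕ) :
    f ^ k ∈ V k := by
  induction k with
  | zero => simpa using hV.one_mem
  | succ k ih => rw [pow_succ]; exact hV.mul_mem ih hf

theorem prod_mem (hV : IsDegreeFiltration V) {ι : Type*} (s : Finset ι) {f : ι → ℝ → ℝ}
    {e : ι → ℕ} (hf : ∀ i, f i ∈ V (e i)) : ∏ i ∈ s, f i ∈ V (∑ i ∈ s, e i) := by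
  classical
  induction s using Finset.induction_on with
  | empty => simpa using hV.one_mem
  | insert i s hi ih =>
    rw [Finset.prod_insert hi, Finset.sum_insert hi]
    exact hV.mul_mem (hf i) ih

theorem eval_mem (hV : IsDegreeFiltration V) {d n : ℕ} {p : MvPolynomial (Fin d) ℝ}
    (hp : p.totalDegree ≤ n) {τ : Fin d → ℝ → ℝ} (hτ : ∀ l, τ l ∈ V 1) :
    (fun s => MvPolynomial.eval (fun l => τ l s) p) ∈ V n := by
  have : (fun s => MvPolynomial.eval (fun l => τ l s) p) =
      ∑ e ∈ p.support, MvPolynomial.coeff e p • ∏ l, τ l ^ e l := by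
    funext s
    simp [MvPolynomial.eval_eq']
  rw [this]
  refine Submodule.sum_mem _ fun e he => Submodule.smul_mem _ _ ?_
  refine hV.mono ?_ (hV.prod_mem Finset.univ fun l => hV.pow_mem (hτ l) (e l))
  refine le_trans ?_ ((MvPolynomial.le_totalDegree he).trans hp)
  rw [Finsupp.sum_fintype _ _ (fun _ => rfl)]

end IsDegreeFiltration

theorem isDegreeFiltration_algSpace : IsDegreeFiltration algSpace where
  mono := by
    intro i j hij
    refine Submodule.span_mono ?_
    rintro f ⟨k, hk, rfl⟩
    exact ⟨k, hk.trans hij, rfl⟩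
  one_mem := Submodule.subset_span ⟨0, le_rfl, by funext t; simp⟩
  mul_mem := by
    intro i j f g hf hg
    have h := Submodule.mul_mem_mul hf hg
    rw [algSpace, algSpace, Submodule.span_mul_span] at h
    refine Submodule.span_mono ?_ h
    rintro _ ⟨_, ⟨k, hk, rfl⟩, _, ⟨l, hl, rfl⟩, rfl⟩
    exact ⟨k + l, by omega, by funext t; simp [pow_add]⟩

theorem cos_int_mul_mem_trigSpace {n : ℕ} {k : ℤ} (hk : k.natAbs ≤ n) :
    (fun θ => Real.cos (k * θ)) ∈ trigSpace n := by
  refine Submodule.subset_span ⟨k.natAbs, hk, Or.inl ?_⟩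
  funext θ
  rcases Int.natAbs_eq k with h | h <;> rw [h] <;> simp

theorem sin_int_mul_mem_trigSpace {n : ℕ} {k : ℤ} (hk : k.natAbs ≤ n) :
    (fun θ => Real.sin (k * θ)) ∈ trigSpace n := by
  have h0 : (fun θ => Real.sin ((k.natAbs : ℕ) * θ)) ∈ trigSpace n :=
    Submodule.subset_span ⟨k.natAbs, hk, Or.inr rfl⟩
  rcases Int.natAbs_eq k with h | h
  · convert h0 using 3
    rw [h]; simp
  · convert (trigSpace n).neg_mem h0 using 1
    funext θ
    rw [h]; simp

theorem isDegreeFiltration_trigSpace : IsDegreeFiltration trigSpace where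
  mono := by
    intro i j hij
    refine Submodule.span_mono ?_
    rintro f ⟨k, hk, h⟩
    exact ⟨k, hk.trans hij, h⟩
  one_mem := Submodule.subset_span ⟨0, le_rfl, Or.inl (by funext t; simp)⟩
  mul_mem := by
    intro i j f g hf hg
    have h := Submodule.mul_mem_mul hf hg
    rw [trigSpace, trigSpace, Submodule.span_mul_span] at h
    refine Submodule.span_le.2 ?_ h
    have hcomb : ∀ (F : ℝ → ℝ) {G H : ℝ → ℝ} (c d : ℝ), G ∈ trigSpace (i + j) →
        H ∈ trigSpace (i + j) → (∀ θ, F θ = c * G θ + d * H θ) → F ∈ trigSpace (i + j) := by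
      intro F G H c d hG hH hF
      convert (trigSpace (i + j)).add_mem ((trigSpace (i + j)).smul_mem c hG)
        ((trigSpace (i + j)).smul_mem d hH) using 1
      funext θ
      simp [hF]
    rintro _ ⟨_, ⟨k, hk, hf⟩, _, ⟨l, hl, hg⟩, rfl⟩
    have hadd : ((k : ℤ) + l).natAbs ≤ i + j := by omega
    have hsub : ((k : ℤ) - l).natAbs ≤ i + j := by omega
    have ea : ∀ θ : ℝ, ((k : ℤ) + l : ℤ) * θ = k * θ + l * θ := by intro θ; push_cast; ring
    have es : ∀ θ : ℝ, ((k : ℤ) - l : ℤ) * θ = k * θ - l * θ := by intro θ; push_cast; ring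
    rcases hf with rfl | rfl <;> rcases hg with rfl | rfl
    · refine hcomb _ (1 / 2) (1 / 2) (cos_int_mul_mem_trigSpace hadd)
        (cos_int_mul_mem_trigSpace hsub) fun θ => ?_
      simp only [ea, es, Real.cos_add, Real.cos_sub, Pi.mul_apply]; ring
    · refine hcomb _ (1 / 2) (-1 / 2) (sin_int_mul_mem_trigSpace hadd)
        (sin_int_mul_mem_trigSpace hsub) fun θ => ?_
      simp only [ea, es, Real.sin_add, Real.sin_sub, Pi.mul_apply]; ring
    · refine hcomb _ (1 / 2) (1 / 2) (sin_int_mul_mem_trigSpace hadd)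
        (sin_int_mul_mem_trigSpace hsub) fun θ => ?_
      simp only [ea, es, Real.sin_add, Real.sin_sub, Pi.mul_apply]; ring
    · refine hcomb _ (-1 / 2) (1 / 2) (cos_int_mul_mem_trigSpace hadd)
        (cos_int_mul_mem_trigSpace hsub) fun θ => ?_
      simp only [ea, es, Real.cos_add, Real.cos_sub, Pi.mul_apply]; ring

theorem prod_update_eq {ι : Type*} [Fintype ι] [DecidableEq ι] (g : ι → ℝ → ℝ) (x : ι → ℝ)
    (i : ι) (s : ℝ) :
    ∏ j, g j (Function.update x i s j) = (∏ j ∈ Finset.univ.erase i, g j (x j)) * g i s := by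
  rw [← Finset.mul_prod_erase _ _ (Finset.mem_univ i), Function.update_self, mul_comm]
  congr 1
  refine Finset.prod_congr rfl fun j hj => ?_
  rw [Function.update_of_ne (Finset.ne_of_mem_erase hj)]

theorem tensorSpace_update_fst {r q n : ℕ} {f : (Fin r → ℝ) × (Fin q → ℝ) → ℝ}
    (hf : f ∈ tensorSpace r q n) (x : Fin r → ℝ) (y : Fin q → ℝ) (i : Fin r) :
    (fun s => f (Function.update x i s, y)) ∈ algSpace n := by
  induction hf using Submodule.span_induction with
  | mem f h =>
    obtain ⟨g, h, hg, -, rfl⟩ := h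
    convert (algSpace n).smul_mem
      ((∏ j ∈ Finset.univ.erase i, g j (x j)) * ∏ j, h j (y j)) (hg i) using 1
    funext s
    simp only [prod_update_eq, Pi.smul_apply, smul_eq_mul]
    ring
  | zero => exact (algSpace n).zero_mem
  | add f g _ _ hf hg => exact (algSpace n).add_mem hf hg
  | smul c f _ hf => exact (algSpace n).smul_mem c hf

theorem tensorSpace_update_snd {r q n : ℕ} {f : (Fin r → ℝ) × (Fin q → ℝ) → ℝ}
    (hf : f ∈ tensorSpace r q n) (x : Fin r → ℝ) (y : Fin q → ℝ) (i : Fin q) :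
    (fun s => f (x, Function.update y i s)) ∈ trigSpace n := by
  induction hf using Submodule.span_induction with
  | mem f h =>
    obtain ⟨g, h, -, hh, rfl⟩ := h
    convert (trigSpace n).smul_mem
      ((∏ j, g j (x j)) * ∏ j ∈ Finset.univ.erase i, h j (y j)) (hh i) using 1
    funext s
    simp only [prod_update_eq, Pi.smul_apply, smul_eq_mul]
    ring
  | zero => exact (trigSpace n).zero_mem
  | add f g _ _ hf hg => exact (trigSpace n).add_mem hf hg
  | smul c f _ hf => exact (trigSpace n).smul_mem c hf

theorem continuous_of_mem_tensorSpace {r q n : ℕ} {f : (Fin r → ℝ) × (Fin q → ℝ) → ℝ}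
    (hf : f ∈ tensorSpace r q n) : Continuous f := by
  induction hf using Submodule.span_induction with
  | mem f h =>
    obtain ⟨g, h, hg, hh, rfl⟩ := h
    have hg' := fun i => continuous_of_mem_algSpace (hg i)
    have hh' := fun i => continuous_of_mem_trigSpace (hh i)
    fun_prop
  | zero => exact continuous_zero
  | add f g _ _ hf hg => exact hf.add hg
  | smul c f _ hf => exact hf.const_smul c

/-- Univariate norming inequalities in each variable give a norming inequality on the grid. -/
theorem abs_le_prod_mul_of_coordinatewise {ι : Type*} [Fintype ι] [DecidableEq ι]
    {g : (ι → ℝ) → ℝ} {S : ι → Set ℝ} {X : ι → Finset ℝ} {C : ι → ℝ}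
    (hX : ∀ i, ∀ s ∈ X i, s ∈ S i)
    (h : ∀ i x, (∀ j, x j ∈ S j) → ∀ B, (∀ s ∈ X i, |g (Function.update x i s)| ≤ B) →
      |g x| ≤ C i * B)
    {B : ℝ} (hB : ∀ x, (∀ i, x i ∈ X i) → |g x| ≤ B) (x : ι → ℝ) (hx : ∀ i, x i ∈ S i) :
    |g x| ≤ (∏ i, C i) * B := by
  -- Here s is the set of coordinates that are still free; those outside s already sit at nodes.
  suffices ∀ s : Finset ι, ∀ x : ι → ℝ, (∀ i, x i ∈ S i) → (∀ i ∉ s, x i ∈ X i) →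
      |g x| ≤ (∏ i ∈ s, C i) * B from this Finset.univ x hx (by simp)
  intro s
  induction s using Finset.induction_on with
  | empty =>
    intro x _ hxX
    simpa using hB x (by simpa using hxX)
  | insert i s hi ih =>
    intro x hxS hxX
    rw [Finset.prod_insert hi, mul_assoc]
    refine h i x hxS _ fun t ht => ih _ (fun j => ?_) (fun j hj => ?_)
    · rcases eq_or_ne j i with rfl | hji
      · simpa using hX _ _ ht
      · simpa [hji] using hxS j
    · rcases eq_or_ne j i with rfl | hji
      · simpa using ht
      · simpa [hji] using hxX j (by simp [hji, hj])

/-! ### Location and number of nodes, and the dimension of the polynomial space on K. -/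

theorem mem_Icc_of_mem_lobattoNodes {ν a b s : ℝ} (hab : a ≤ b) (hs : s ∈ lobattoNodes ν a b) :
    s ∈ Set.Icc a b := by
  obtain ⟨j, -, rfl⟩ := Finset.mem_image.1 hs
  have h1 := Real.neg_one_le_cos (j * Real.pi / (⌈ν⌉₊ : ℝ))
  have h2 := Real.cos_le_one (j * Real.pi / (⌈ν⌉₊ : ℝ))
  constructor <;> nlinarith

theorem mem_Icc_of_mem_angularNodes {ν u v s : ℝ} (huv : u ≤ v) (hper : v - u ≤ 2 * Real.pi)
    (hs : s ∈ angularNodes ν u v) : s ∈ Set.Icc u v := by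
  obtain ⟨t, ht, rfl⟩ := Finset.mem_image.1 hs
  obtain ⟨j, -, rfl⟩ := Finset.mem_image.1 ht
  have h := psi_mem_Icc (ω := (v - u) / 2) (by linarith) (by linarith)
    (Real.abs_cos_le_one ((2 * j + 1) * Real.pi / (2 * ((⌈2 * ν⌉₊ : ℕ) + 1))))
  exact ⟨by linarith [h.1], by linarith [h.2]⟩

theorem card_lobattoNodes_le (ν a b : ℝ) : (lobattoNodes ν a b).card ≤ ⌈ν⌉₊ + 1 :=
  Finset.card_image_le.trans (Finset.card_range _).le

theorem card_angularNodes_le (ν u v : ℝ) : (angularNodes ν u v).card ≤ ⌈2 * ν⌉₊ + 1 :=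
  Finset.card_image_le.trans (Finset.card_image_le.trans (Finset.card_range _).le)

theorem angularNodes_nonempty (ν u v : ℝ) : (angularNodes ν u v).Nonempty :=
  Finset.Nonempty.image (Finset.Nonempty.image ⟨0, by simp⟩ _) _

theorem supNormOn_nonneg {E : Type*} (X : Set E) (f : E → ℝ) : 0 ≤ supNormOn X f :=
  Real.sSup_nonneg (by rintro _ ⟨x, -, rfl⟩; exact abs_nonneg _)

theorem abs_le_supNormOn_finset {E : Type*} (X : Finset E) (f : E → ℝ) {x : E} (hx : x ∈ X) :
    |f x| ≤ supNormOn (X : Set E) f :=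
  le_csSup ((X.finite_toSet.image _).bddAbove) ⟨x, hx, rfl⟩

theorem card_sectionMesh_le {d r q : ℕ} (σ : (Fin r → ℝ) × (Fin q → ℝ) → Fin d → ℝ)
    (a b : Fin r → ℝ) (u v : Fin q → ℝ) {m : ℝ} (hm : 0 ≤ m) (n : ℕ) :
    (sectionMesh σ a b u v m n).card ≤ ⌈m * n + 1⌉₊ ^ r * ⌈2 * m * n + 1⌉₊ ^ q := by
  refine Finset.card_image_le.trans ?_
  rw [boxGrid, Finset.card_product, Fintype.card_piFinset, Fintype.card_piFinset,
    Nat.ceil_add_one (by positivity), Nat.ceil_add_one (by positivity), mul_assoc 2 m]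
  refine Nat.mul_le_mul ?_ ?_
  · refine (Finset.prod_le_pow_card _ _ _ fun i _ => card_lobattoNodes_le _ _ _).trans ?_
    simp
  · refine (Finset.prod_le_pow_card _ _ _ fun i _ => card_angularNodes_le _ _ _).trans ?_
    simp

instance {d : ℕ} (K : Set (Fin d → ℝ)) (n : ℕ) : Module.Finite ℝ (polySpaceOn K n) := by
  unfold polySpaceOn; infer_instance

theorem pow_mem_polySpaceOn {d : ℕ} (K : Set (Fin d → ℝ)) (l : Fin d) {n i : ℕ} (hi : i ≤ n) :
    (fun x : K => x.1 l ^ i) ∈ polySpaceOn K n := by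
  refine ⟨MvPolynomial.X l ^ i, ?_, ?_⟩
  · rw [SetLike.mem_coe, MvPolynomial.mem_restrictTotalDegree, MvPolynomial.totalDegree_X_pow]
    exact hi
  · funext x
    simp

/-- The powers 1, x_l, …, x_l^n are independent on K: a relation between them is a univariate
polynomial with infinitely many roots. -/
theorem succ_le_finrank_polySpaceOn {d : ℕ} {K : Set (Fin d → ℝ)} {l : Fin d}
    (hK : ((fun x => x l) '' K).Infinite) (n : ℕ) :
    n + 1 ≤ Module.finrank ℝ (polySpaceOn K n) := by
  let e : Fin (n + 1) → polySpaceOn K n := fun i =>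
    ⟨fun x : K => x.1 l ^ (i : ℕ), pow_mem_polySpaceOn K l (Nat.lt_succ_iff.1 i.2)⟩
  have he : LinearIndependent ℝ e := by
    rw [Fintype.linearIndependent_iff]
    intro c hc
    have hP : (∑ i : Fin (n + 1), Polynomial.C (c i) * Polynomial.X ^ (i : ℕ)) = 0 := by
      refine Polynomial.eq_zero_of_infinite_isRoot _ (hK.mono ?_)
      rintro _ ⟨x, hx, rfl⟩
      have := congrFun (congrArg Subtype.val hc) ⟨x, hx⟩
      simpa [e, Polynomial.eval_finsetSum] using this
    intro i
    have := congrArg (fun P => Polynomial.coeff P i) hP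
    simpa [Polynomial.finsetSum_coeff, Polynomial.coeff_X_pow, Fin.val_inj, eq_comm] using this
  simpa using he.fintype_card_le_finrank

theorem one_le_finrank_polySpaceOn {d : ℕ} {K : Set (Fin d → ℝ)} (hK : K.Nonempty) (n : ℕ) :
    1 ≤ Module.finrank ℝ (polySpaceOn K n) := by
  obtain ⟨x, hx⟩ := hK
  have h1 : (fun _ : K => (1 : ℝ)) ∈ polySpaceOn K n :=
    ⟨1, by rw [SetLike.mem_coe, MvPolynomial.mem_restrictTotalDegree]; simp, by funext x; simp⟩
  refine Nat.one_le_iff_ne_zero.2 (Module.finrank_pos_iff_exists_ne_zero.2 ⟨⟨_, h1⟩, ?_⟩).ne'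
  intro h
  exact one_ne_zero (congrFun (congrArg Subtype.val h) ⟨x, hx⟩)

theorem exists_infinite_image_of_isPreconnected {d : ℕ} {K : Set (Fin d → ℝ)}
    (hK : IsPreconnected K) (hnt : K.Nontrivial) : ∃ l, ((fun x => x l) '' K).Infinite := by
  obtain ⟨x, hx, y, hy, hxy⟩ := hnt
  obtain ⟨l, hl⟩ := Function.ne_iff.1 hxy
  have hpre := hK.image (fun x => x l) (by fun_prop)
  refine ⟨l, ?_⟩
  rcases lt_or_gt_of_ne hl with h | h
  · exact (Set.Icc_infinite h).mono
      (hpre.Icc_subset (Set.mem_image_of_mem _ hx) (Set.mem_image_of_mem _ hy))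
  · exact (Set.Icc_infinite h).mono
      (hpre.Icc_subset (Set.mem_image_of_mem _ hy) (Set.mem_image_of_mem _ hx))

/-- If K is a point the dimension need not grow, but then the cardinality is at most 1. The exponent
is e + 1 rather than e so that it is at least 1 even when e = 0. -/
theorem isBigO_card_of_isPreconnected {d : ℕ} {K : Set (Fin d → ℝ)} (hK : IsPreconnected K)
    (hne : K.Nonempty) {A : ℕ → Finset (Fin d → ℝ)} (hA : ∀ n, (A n : Set (Fin d → ℝ)) ⊆ K)
    {c : ℝ} (hc : 1 ≤ c) {e : ℕ} (hcard : ∀ n : ℕ, ((A n).card : ℝ) ≤ c * (n + 1) ^ e) :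
    (fun n => ((A n).card : ℝ)) =O[Filter.atTop]
      (fun n => (Module.finrank ℝ (polySpaceOn K n) : ℝ) ^ ((e + 1 : ℕ) : ℝ)) := by
  refine Asymptotics.IsBigO.of_bound c (Filter.Eventually.of_forall fun n => ?_)
  rw [Real.rpow_natCast, Real.norm_of_nonneg (by positivity), Real.norm_of_nonneg (by positivity)]
  rcases K.subsingleton_or_nontrivial with hs | hnt
  · have h1 : ((A n).card : ℝ) ≤ 1 := by
      exact_mod_cast Finset.card_le_one.2 fun x hx y hy => hs (hA n hx) (hA n hy)
    have h2 : (1 : ℝ) ≤ Module.finrank ℝ (polySpaceOn K n) := by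
      exact_mod_cast one_le_finrank_polySpaceOn hne n
    exact h1.trans (one_le_mul_of_one_le_of_one_le hc (one_le_pow₀ h2))
  · obtain ⟨l, hl⟩ := exists_infinite_image_of_isPreconnected hK hnt
    have h2 : (n + 1 : ℝ) ≤ Module.finrank ℝ (polySpaceOn K n) := by
      exact_mod_cast succ_le_finrank_polySpaceOn hl n
    refine (hcard n).trans ?_
    gcongr
    calc ((n : ℝ) + 1) ^ e ≤ (n + 1 : ℝ) ^ (e + 1) :=
          pow_le_pow_right₀ (by linarith [(Nat.cast_nonneg n : (0 : ℝ) ≤ n)]) (Nat.le_succ e)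
      _ ≤ _ := by gcongr

/-! ### Norming inequality on the grid and the final assembly. -/

theorem mem_box_iff {r q : ℕ} {a b : Fin r → ℝ} {u v : Fin q → ℝ}
    {x : (Fin r → ℝ) × (Fin q → ℝ)} :
    x ∈ box a b u v ↔ (∀ i, x.1 i ∈ Set.Icc (a i) (b i)) ∧ ∀ j, x.2 j ∈ Set.Icc (u j) (v j) := by
  simp only [box, Set.mem_prod, Set.mem_Icc, Pi.le_def, forall_and]

theorem mem_boxGrid_iff {r q : ℕ} {a b : Fin r → ℝ} {u v : Fin q → ℝ} {m : ℝ} {n : ℕ}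
    {x : (Fin r → ℝ) × (Fin q → ℝ)} :
    x ∈ boxGrid a b u v m n ↔ (∀ i, x.1 i ∈ lobattoNodes (m * n) (a i) (b i)) ∧
      ∀ j, x.2 j ∈ angularNodes (m * n) (u j) (v j) := by
  simp only [boxGrid, Finset.mem_product, Fintype.mem_piFinset]

/-- The grid of nodes norms the compositions of polynomials with maps of tensor degree one. -/
theorem abs_eval_le_of_boxGrid {d r q n : ℕ} {a b : Fin r → ℝ} {u v : Fin q → ℝ}
    (hab : ∀ i, a i ≤ b i) (huv : ∀ j, u j ≤ v j) (hper : ∀ j, v j - u j ≤ 2 * Real.pi)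
    {F : Fin d → (Fin r → ℝ) × (Fin q → ℝ) → ℝ} (hF : ∀ l, F l ∈ tensorSpace r q 1)
    {m B : ℝ} (hm : 1 < m) {C : Fin q → ℝ}
    (hC : ∀ j, 1 / Real.cos (Real.pi / (2 * m)) ≤ C j)
    {p : MvPolynomial (Fin d) ℝ} (hp : p.totalDegree ≤ n)
    (hB : ∀ x ∈ boxGrid a b u v m n, |MvPolynomial.eval (fun l => F l x) p| ≤ B)
    {x : (Fin r → ℝ) × (Fin q → ℝ)} (hx : x ∈ box a b u v) :
    |MvPolynomial.eval (fun l => F l x) p| ≤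
      (1 / Real.cos (Real.pi / (2 * m))) ^ r * (∏ j, C j) * B := by
  obtain ⟨x₁, x₂⟩ := x
  rw [mem_box_iff] at hx
  have hgrid : ∀ y : Fin r → ℝ, (∀ i, y i ∈ lobattoNodes (m * n) (a i) (b i)) →
      |MvPolynomial.eval (fun l => F l (y, x₂)) p| ≤ (∏ j, C j) * B := by
    intro y hy
    refine abs_le_prod_mul_of_coordinatewise (S := fun j => Set.Icc (u j) (v j))
      (X := fun j => angularNodes (m * n) (u j) (v j)) (C := C)
      (g := fun z => MvPolynomial.eval (fun l => F l (y, z)) p)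
      (fun j s hs => mem_Icc_of_mem_angularNodes (huv j) (hper j) hs)
      ?_
      (fun z hz => hB _ (mem_boxGrid_iff.2 ⟨hy, hz⟩)) x₂ hx.2
    intro j z hz B' hB'
    -- Enlarging the constant to C j needs B' ≥ 0, which holds because there is at least one node.
    have hB'0 : 0 ≤ B' := by
      obtain ⟨s, hs⟩ := angularNodes_nonempty (m * n) (u j) (v j)
      exact (abs_nonneg _).trans (hB' s hs)
    have h := abs_le_of_angularNodes (isDegreeFiltration_trigSpace.eval_mem hp
      fun l => tensorSpace_update_snd (hF l) y z j) (hper j) hm hB' (hz j)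
    simp only [Function.update_eq_self] at h
    exact h.trans (mul_le_mul_of_nonneg_right (hC j) hB'0)
  have h := abs_le_prod_mul_of_coordinatewise (S := fun i => Set.Icc (a i) (b i))
    (X := fun i => lobattoNodes (m * n) (a i) (b i))
    (C := fun _ => 1 / Real.cos (Real.pi / (2 * m)))
    (g := fun y => MvPolynomial.eval (fun l => F l (y, x₂)) p)
    (fun i s hs => mem_Icc_of_mem_lobattoNodes (hab i) hs)
    (by
      intro i y hy B' hB'
      have h := abs_le_of_lobattoNodes (isDegreeFiltration_algSpace.eval_mem hp
        fun l => tensorSpace_update_fst (hF l) y x₂ i) hm hB' (hy i)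
      simpa only [Function.update_eq_self] using h) hgrid x₁ hx.1
  simpa [mul_assoc] using h

end

theorem proposition1 (d d₁ d₂ d₃ : ℕ)
    (a b : Fin d₁ → ℝ) (u v : Fin (d₂ + d₃) → ℝ)
    (hab : ∀ i, a i ≤ b i) (huv : ∀ j, u j ≤ v j)
    (hper : ∀ j : Fin d₂, v (Fin.castAdd d₃ j) - u (Fin.castAdd d₃ j) = 2 * Real.pi)
    (hsub : ∀ j : Fin d₃, v (Fin.natAdd d₂ j) - u (Fin.natAdd d₂ j) < 2 * Real.pi)
    (σ : (Fin d₁ → ℝ) × (Fin (d₂ + d₃) → ℝ) → Fin d → ℝ)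
    (hσ : ∀ l : Fin d, ∃ f ∈ tensorSpace d₁ (d₂ + d₃) 1,
      Set.EqOn (fun x => σ x l) f (box a b u v))
    (m : ℝ) (hm : 1 < m) :
    IsPolynomialMesh (σ '' box a b u v) (sectionMesh σ a b u v m) ∧
    ∀ n : ℕ,
      (∀ p : MvPolynomial (Fin d) ℝ, p.totalDegree ≤ n →
        supNormOn (σ '' box a b u v) (fun x => MvPolynomial.eval x p) ≤
          (1 / Real.cos (Real.pi / (2 * m))) ^ (d₁ + d₂) * (m / (m - 1)) ^ d₃ *
            supNormOn (sectionMesh σ a b u v m n : Set (Fin d → ℝ))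
              (fun x => MvPolynomial.eval x p)) ∧
      (sectionMesh σ a b u v m n).card ≤
        ⌈m * n + 1⌉₊ ^ d₁ * ⌈2 * m * n + 1⌉₊ ^ (d₂ + d₃) := by
  have hm0 : 0 < m := by linarith
  have hlen : ∀ j, v j - u j ≤ 2 * Real.pi := fun j =>
    Fin.addCases (motive := fun j => v j - u j ≤ 2 * Real.pi) (fun j => (hper j).le)
      (fun j => (hsub j).le) j
  choose F hF hFσ using hσ
  have hσF : ∀ x ∈ box a b u v, σ x = fun l => F l x := fun x hx => funext fun l => hFσ l hx
  have hne : (σ '' box a b u v).Nonempty :=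
    ⟨_, (a, u), mem_box_iff.2 ⟨fun i => ⟨le_rfl, hab i⟩, fun j => ⟨le_rfl, huv j⟩⟩, rfl⟩
  have hcont : ContinuousOn σ (box a b u v) := by
    refine ContinuousOn.congr (f := fun x l => F l x) ?_ hσF
    exact (continuous_pi fun l => continuous_of_mem_tensorSpace (hF l)).continuousOn
  have hgrid : ∀ n, ∀ x ∈ boxGrid a b u v m n, x ∈ box a b u v := by
    intro n x hx
    rw [mem_boxGrid_iff] at hx
    exact mem_box_iff.2 ⟨fun i => mem_Icc_of_mem_lobattoNodes (hab i) (hx.1 i),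
      fun j => mem_Icc_of_mem_angularNodes (huv j) (hlen j) (hx.2 j)⟩
  have hmesh : ∀ n, (sectionMesh σ a b u v m n : Set (Fin d → ℝ)) ⊆ σ '' box a b u v := by
    intro n x hx
    obtain ⟨y, hy, rfl⟩ := Finset.mem_image.1 hx
    exact ⟨y, hgrid n y hy, rfl⟩
  have hnorm : ∀ n : ℕ, ∀ p : MvPolynomial (Fin d) ℝ, p.totalDegree ≤ n →
      supNormOn (σ '' box a b u v) (fun x => MvPolynomial.eval x p) ≤
        (1 / Real.cos (Real.pi / (2 * m))) ^ (d₁ + d₂) * (m / (m - 1)) ^ d₃ *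
          supNormOn (sectionMesh σ a b u v m n : Set (Fin d → ℝ))
            (fun x => MvPolynomial.eval x p) := by
    intro n p hp
    refine csSup_le (hne.image _) ?_
    rintro _ ⟨_, ⟨x, hx, rfl⟩, rfl⟩
    simp only
    rw [hσF x hx]
    refine (abs_eval_le_of_boxGrid hab huv hlen hF hm
      (C := fun j => Fin.addCases (fun _ : Fin d₂ => 1 / Real.cos (Real.pi / (2 * m)))
        (fun _ : Fin d₃ => m / (m - 1)) j) ?_ hp (B := supNormOn (sectionMesh σ a b u v m n : Set (Fin d → ℝ))
        (fun x => MvPolynomial.eval x p)) ?_ hx).trans_eq ?_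
    · intro j
      refine Fin.addCases (fun j => ?_) (fun j => ?_) j
      · rw [Fin.addCases_left]
      · rw [Fin.addCases_right]
        exact one_div_cos_le hm
    · intro y hy
      rw [← hσF y (hgrid n y hy)]
      exact abs_le_supNormOn_finset (sectionMesh σ a b u v m n) (fun x => MvPolynomial.eval x p)
        (Finset.mem_image_of_mem σ hy)
    · rw [Fin.prod_univ_add]
      simp only [Fin.addCases_left, Fin.addCases_right, Finset.prod_const, Finset.card_univ,
        Fintype.card_fin]
      rw [pow_add]
      ring
  have hcard : ∀ n : ℕ, (sectionMesh σ a b u v m n).card ≤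
      ⌈m * n + 1⌉₊ ^ d₁ * ⌈2 * m * n + 1⌉₊ ^ (d₂ + d₃) :=
    fun n => card_sectionMesh_le σ a b u v hm0.le n
  refine ⟨⟨?_, hmesh, ?_, ?_⟩, fun n => ⟨hnorm n, hcard n⟩⟩
  · exact (isCompact_Icc.prod isCompact_Icc).image_of_continuousOn hcont
  · have hκ : 0 ≤ (1 / Real.cos (Real.pi / (2 * m))) ^ (d₁ + d₂) * (m / (m - 1)) ^ d₃ := by
      have h1 := cos_pi_div_two_mul_pos hm
      have h2 : 0 < m - 1 := by linarith
      positivity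
    -- Adding 2 ensures c > 1; the product of constants itself equals 1 when there are no variables.
    refine ⟨(1 / Real.cos (Real.pi / (2 * m))) ^ (d₁ + d₂) * (m / (m - 1)) ^ d₃ + 2, by linarith,
      fun n p hp => (hnorm n p hp).trans ?_⟩
    exact mul_le_mul_of_nonneg_right (by linarith) (supNormOn_nonneg _ _)
  · have hpre : IsPreconnected (σ '' box a b u v) :=
      ((convex_Icc a b).prod (convex_Icc u v)).isPreconnected.image σ hcont
    refine ⟨((d₁ + (d₂ + d₃) + 1 : ℕ) : ℝ), by exact_mod_cast Nat.le_add_left _ _,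
      isBigO_card_of_isPreconnected hpre hne hmesh (c := (2 * m + 2) ^ (d₁ + (d₂ + d₃)))
        (one_le_pow₀ (by linarith)) fun n => ?_⟩
    have hn : (0 : ℝ) ≤ n := Nat.cast_nonneg n
    -- Both ceilings are at most 2mn + 2, hence at most (2m + 2)(n + 1).
    have h1 : (⌈m * n + 1⌉₊ : ℝ) ≤ (2 * m + 2) * (n + 1) := by
      have := (Nat.ceil_lt_add_one (show 0 ≤ m * n + 1 by positivity)).le
      nlinarith [mul_nonneg hm0.le hn]
    have h2 : (⌈2 * m * n + 1⌉₊ : ℝ) ≤ (2 * m + 2) * (n + 1) := by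
      have := (Nat.ceil_lt_add_one (show 0 ≤ 2 * m * n + 1 by positivity)).le
      nlinarith [mul_nonneg hm0.le hn]
    calc ((sectionMesh σ a b u v m n).card : ℝ) ≤
          (⌈m * n + 1⌉₊ : ℝ) ^ d₁ * (⌈2 * m * n + 1⌉₊ : ℝ) ^ (d₂ + d₃) := by
          exact_mod_cast hcard n
      _ ≤ ((2 * m + 2) * (n + 1)) ^ d₁ * ((2 * m + 2) * (n + 1)) ^ (d₂ + d₃) := by gcongr
      _ = _ := by rw [← pow_add, mul_pow]
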